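/- Let $\Omega\subset\mathbb R^n$ be a bounded domain with smooth boundary, $D=\Omega\times(0,1)$, and let the scalars be real or complex. Let $\mathcal L_x$ be a self-adjoint unbounded operator in $L_2(\Omega)$ with compact resolvent such that $(\mathcal L_x h,h)\ge\|h\|^2$ for all $h\in\mathcal D(\mathcal L_x)$, and suppose that $\mathcal D(\mathcal L_x)\cap C^2(\overline\Omega)$ is a core of $\mathcal L_x$, i.e. is dense in $\mathcal D(\mathcal L_x)$ for the graph norm (as for an elliptic boundary value problem with $C^2(\overline\Omega)$ eigenfunctions). Let $u_k$, $k\in\mathbb N$, be a complete orthonormal system in $L_2(\Omega)$ of eigenfunctions of $\mathcal L_x$, with eigenvalues $\mu_k$. For each $k$ let $v_{km}$, $m\in\mathbb N$, be a full list of orthonormal (in $L_2(0,1)$) eigenfunctions, with eigenvalues $\lambda_{km}$, of the problem $$v''(t)-\mu_k v(t)=\lambda\, v(1-t),\quad 0<t<1,\qquad v(0)=v'(0)=0,$$ meaning that no eigenfunction of this problem is orthogonal to all the $v_{km}$, $m\in\mathbb N$; let them be numbered so that $|\lambda_{k1}|\le|\lambda_{km}|$ for all $m$. Put $u_{km}(x,t)=u_k(x)v_{km}(t)$.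 For $f\in L_2(D)$ consider the mixed Cauchy problem $$\mathbb L u\equiv u_{tt}-\mathcal L_x u=f \text{ in } D,\qquad u(x,0)=u_t(x,0)=0,\ x\in\Omega .$$ A function $u\in L_2(D)$ is called a strong solution if there are functions $w_n\in C^2(\overline D)$ with $w_n(x,0)=\partial_t w_n(x,0)=0$ for $x\in\Omega$, with $w_n(\cdot,t)\in\mathcal D(\mathcal L_x)$ for every $t\in(0,1)$, and with $\mathbb L w_n\in L_2(D)$, such that $w_n\to u$ and $\mathbb L w_n\to f$ in $L_2(D)$. Then a strong solution exists if and only if $$\sum_{k=1}^\infty\left|\frac{\tilde f_{k1}}{\lambda_{k1}}\right|^2<\infty,\qquad\text{where } \tilde f_{km}=\big(f(x,1-t),u_{km}(x,t)\big)_{L_2(D)} .$$ In that case every strong solution $u$ (so the solution is unique in $L_2(D)$) is given by the series $$u=\sum_{k=1}^\infty\frac{\tilde f_{k1}}{\lambda_{k1}}u_{k1}+\sum_{k=1}^\infty\sum_{m=2}^\infty\frac{\tilde f_{km}}{\lambda_{km}}u_{km},$$ which converges unconditionally in $L_2(D)$. -/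

import Mathlib

open MeasureTheory Set Filter Topology
open scoped ContDiff

/-- `Ω` has smooth boundary: near every boundary point, `Ω` is the negativity set of a smooth
function with non-vanishing differential at that point. -/
def HasSmoothBoundary {d : ℕ} (Ω : Set (EuclideanSpace ℝ (Fin d))) : Prop :=
  ∀ x ∈ frontier Ω, ∃ (U : Set (EuclideanSpace ℝ (Fin d))) (ρ : EuclideanSpace ℝ (Fin d) → ℝ),
    IsOpen U ∧ x ∈ U ∧ ContDiffOn ℝ ∞ ρ U ∧ fderiv ℝ ρ x ≠ 0 ∧ Ω ∩ U = {y ∈ U | ρ y < 0}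

/-- The space `L₂(Ω)`. -/
abbrev L2 (𝕜 : Type*) [RCLike 𝕜] {d : ℕ} (Ω : Set (EuclideanSpace ℝ (Fin d))) : Type _ :=
  Lp 𝕜 2 (volume.restrict Ω)

/-- Lebesgue measure on the cylinder `D = Ω × (0, 1)`; points of `D` are pairs `(x, t)`. -/
noncomputable abbrev cylMeasure {d : ℕ} (Ω : Set (EuclideanSpace ℝ (Fin d))) :
    Measure (EuclideanSpace ℝ (Fin d) × ℝ) :=
  volume.restrict (Ω ×ˢ Ioo (0 : ℝ) 1)

/-- The unbounded operator `L` has compact resolvent: for some `z` in the resolvent set,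
`(L - z)⁻¹` is an everywhere defined compact operator. -/
def HasCompactResolvent {𝕜 H : Type*} [RCLike 𝕜] [NormedAddCommGroup H] [InnerProductSpace 𝕜 H]
    (L : H →ₗ.[𝕜] H) : Prop :=
  ∃ (z : 𝕜) (R : H →L[𝕜] H), IsCompactOperator R ∧
    (∀ h : L.domain, R (L h - z • (h : H)) = h) ∧
    ∀ y : H, ∃ h : L.domain, (h : H) = R y ∧ L h - z • (h : H) = y

/-- The Friedrichs type inequality `(L h, h) ≥ ‖h‖²` on the domain of `L`. -/
def FriedrichsInequality {𝕜 H : Type*} [RCLike 𝕜] [NormedAddCommGroup H] [InnerProductSpace 𝕜 H]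
    (L : H →ₗ.[𝕜] H) : Prop :=
  ∀ h : L.domain, ‖(h : H)‖ ^ 2 ≤ RCLike.re (inner 𝕜 (L h) (h : H))

section
variable {𝕜 : Type*} [RCLike 𝕜] {d : ℕ}

/-- The functions of class `C²` on the closure of `Ω` that belong to the domain of `L` form a core
of `L`: they are dense in the domain of `L` for the graph norm. -/
def HasC2Core (Ω : Set (EuclideanSpace ℝ (Fin d))) (L : L2 𝕜 Ω →ₗ.[𝕜] L2 𝕜 Ω) : Prop :=
  ∀ h : L.domain, ∀ ε : ℝ, 0 < ε →
    ∃ (φ : EuclideanSpace ℝ (Fin d) → 𝕜) (g : L.domain),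
      ContDiffOn ℝ 2 φ (closure Ω) ∧
      ((g : L2 𝕜 Ω) : EuclideanSpace ℝ (Fin d) → 𝕜) =ᵐ[volume.restrict Ω] φ ∧
      ‖(g : L2 𝕜 Ω) - h‖ < ε ∧ ‖L g - L h‖ < ε

/-- `w` is of class `C²` on the closed cylinder, satisfies `w(x, 0) = w_t(x, 0) = 0` for `x ∈ Ω`,
and `w(·, t)` belongs to the domain of `L` for every `t ∈ (0, 1)`. -/
structure IsAdmissible (Ω : Set (EuclideanSpace ℝ (Fin d))) (L : L2 𝕜 Ω →ₗ.[𝕜] L2 𝕜 Ω)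
    (w : EuclideanSpace ℝ (Fin d) × ℝ → 𝕜) : Prop where
  contDiffOn : ContDiffOn ℝ 2 w (closure Ω ×ˢ Icc (0 : ℝ) 1)
  initial : ∀ x ∈ Ω, w (x, 0) = 0
  initial_deriv : ∀ x ∈ Ω, HasDerivWithinAt (fun t : ℝ => w (x, t)) 0 (Icc (0 : ℝ) 1) 0
  mem_domain : ∀ t ∈ Ioo (0 : ℝ) 1, ∃ h : L.domain,
    ((h : L2 𝕜 Ω) : EuclideanSpace ℝ (Fin d) → 𝕜) =ᵐ[volume.restrict Ω] fun x => w (x, t)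

/-- `w_tt - L w = g` in `L₂(D)`, the operator `L` acting in the variable `x`. -/
def IsImage (Ω : Set (EuclideanSpace ℝ (Fin d))) (L : L2 𝕜 Ω →ₗ.[𝕜] L2 𝕜 Ω)
    (w g : EuclideanSpace ℝ (Fin d) × ℝ → 𝕜) : Prop :=
  MemLp g 2 (cylMeasure Ω) ∧
  ∀ᵐ t ∂(volume.restrict (Ioo (0 : ℝ) 1)), ∃ h : L.domain,
    ((h : L2 𝕜 Ω) : EuclideanSpace ℝ (Fin d) → 𝕜) =ᵐ[volume.restrict Ω] (fun x => w (x, t)) ∧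
    (fun x => g (x, t)) =ᵐ[volume.restrict Ω]
      fun x => iteratedDeriv 2 (fun s : ℝ => w (x, s)) t - (L h : L2 𝕜 Ω) x

/-- `u` is a strong solution of `u_tt - L u = f`, `u(x, 0) = u_t(x, 0) = 0`: it is the limit in
`L₂(D)` of admissible functions `w n` whose images `w_tt - L w` converge to `f` in `L₂(D)`. -/
def IsStrongSolution (Ω : Set (EuclideanSpace ℝ (Fin d))) (L : L2 𝕜 Ω →ₗ.[𝕜] L2 𝕜 Ω)
    (f u : EuclideanSpace ℝ (Fin d) × ℝ → 𝕜) : Prop :=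
  MemLp u 2 (cylMeasure Ω) ∧
  ∃ w g : ℕ → EuclideanSpace ℝ (Fin d) × ℝ → 𝕜,
    (∀ n, IsAdmissible Ω L (w n)) ∧ (∀ n, IsImage Ω L (w n) (g n)) ∧
    Tendsto (fun n => eLpNorm (w n - u) 2 (cylMeasure Ω)) atTop (𝓝 0) ∧
    Tendsto (fun n => eLpNorm (g n - f) 2 (cylMeasure Ω)) atTop (𝓝 0)

/-- `v` solves the Cauchy problem with deviating argument
`v''(t) - μ v(t) = lam v(1 - t)`, `0 < t < 1`, `v(0) = v'(0) = 0`. -/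
structure SolvesDeviating (μ : ℝ) (lam : 𝕜) (v : ℝ → 𝕜) : Prop where
  contDiffOn : ContDiffOn ℝ 2 v (Icc (0 : ℝ) 1)
  equation : ∀ t ∈ Ioo (0 : ℝ) 1, iteratedDeriv 2 v t - (μ : 𝕜) * v t = lam * v (1 - t)
  initial : v 0 = 0
  initial_deriv : HasDerivWithinAt v 0 (Icc (0 : ℝ) 1) 0

/-- `v 0, v 1, …` are all the orthonormal eigenfunctions of the deviating problem with parameter
`μ`, with eigenvalues `lam 0, lam 1, …`, the eigenvalue of smallest modulus coming first. The list
is exhaustive: no eigenfunction is orthogonal to all of the `v m`. -/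
structure IsDeviatingEigensystem (μ : ℝ) (lam : ℕ → 𝕜) (v : ℕ → ℝ → 𝕜) : Prop where
  solves : ∀ m, SolvesDeviating μ (lam m) (v m)
  orthonormal : ∀ m m',
    ∫ t in (0 : ℝ)..1, v m t * (starRingEnd 𝕜) (v m' t) = if m = m' then 1 else 0
  exhaustive : ∀ (l : 𝕜) (y : ℝ → 𝕜), SolvesDeviating μ l y →
    (∀ m, ∫ t in (0 : ℝ)..1, y t * (starRingEnd 𝕜) (v m t) = 0) → ∀ t ∈ Icc (0 : ℝ) 1, y t = 0
  least : ∀ m, ‖lam 0‖ ≤ ‖lam m‖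

/-- The product `U(x, t) = e(x) v(t)`. -/
def prodFun (e : EuclideanSpace ℝ (Fin d) → 𝕜) (v : ℝ → 𝕜) :
    EuclideanSpace ℝ (Fin d) × ℝ → 𝕜 :=
  fun p => e p.1 * v p.2

/-- The coefficient `(f(x, 1 - t), U(x, t))`, the inner product being that of `L₂(D)`. -/
noncomputable def reflCoeff (Ω : Set (EuclideanSpace ℝ (Fin d)))
    (f U : EuclideanSpace ℝ (Fin d) × ℝ → 𝕜) : 𝕜 :=
  ∫ p, f (p.1, 1 - p.2) * (starRingEnd 𝕜) (U p) ∂(cylMeasure Ω)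

end

/-! Let `P` be the reflection `F(x, t) ↦ F(x, 1 - t)` of `L₂(D)`. The Cauchy operator `𝕃` is far
from self-adjoint, but `P𝕃` is symmetric: when Green's identity is composed with the reflection,
each boundary term contains Cauchy data at `t = 0`, which vanish. The deviating problem says exactly
that `𝕃 u_km = λ_km P u_km`, so the products `u_km` are eigenvectors of `P𝕃`. They form a Hilbert
basis of `L₂(D)` (`exists_hilbertBasis_prodFun`), and the closure of the graph of `𝕃` becomes
diagonal: if `(u, f)` lies in it, then `(Pf, u_km) = λ_km (u, u_km)`
(`inner_reflectionLp_of_mem_closure`). This fixes all coefficients of `u`, hence uniqueness and the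
series. Conversely, each `(u_km, λ_km P u_km)` lies in the closed graph
(`tensorLp_mem_closure_operatorGraph`), so a solution exists as soon as the numbers `f̃_km / λ_km`
are square summable.

That only the first column matters comes from `|λ_km| ≥ 2` for all other `m`, uniformly in `k`
(`two_le_norm_eigenvalue`). With `a = √μ_k ≥ 1`, the inverse of the deviating problem is the
integral operator with kernel `fundSol a (t + s - 1)`. This kernel is `e^{a(t+s-1)}/(2a)`, of rank
one, minus `e^{-a|t+s-1|}/(2a)`, bounded by `1/2`; by min-max at most one eigenvalue of the inverse
exceeds `1/2` in modulus.

Completeness in `t` is the spectral theorem for the same operator, which is compact, symmetric and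
injective (`eq_zero_of_forall_inner_eq_zero`). -/

/-- Lebesgue measure on the unit interval `(0, 1)`. -/
noncomputable abbrev unitMeasure : Measure ℝ := volume.restrict (Ioo (0 : ℝ) 1)

instance isProbabilityMeasure_unitMeasure : IsProbabilityMeasure unitMeasure := ⟨by simp⟩

/-! ### Integral operators on `L₂(0, 1)` with continuous real kernels. -/

section KernelOperators

variable {𝕜 : Type*} [RCLike 𝕜]

/-- `A` is the integral operator on `L₂(0, 1)` with the real kernel `κ`. -/
def IsKernelOp (A : Lp 𝕜 2 unitMeasure →L[𝕜] Lp 𝕜 2 unitMeasure) (κ : ℝ → ℝ → ℝ) : Prop :=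
  ∀ g : Lp 𝕜 2 unitMeasure, A g =ᵐ[unitMeasure] fun t => ∫ s, κ t s • g s ∂unitMeasure

theorem integral_norm_le_norm_Lp_two (g : Lp 𝕜 2 unitMeasure) :
    ∫ s, ‖g s‖ ∂unitMeasure ≤ ‖g‖ := by
  have h1 : MemLp g 1 unitMeasure := (Lp.memLp g).mono_exponent (by norm_num)
  rw [Lp.norm_def, integral_norm_eq_lintegral_enorm h1.1, ← eLpNorm_one_eq_lintegral_enorm]
  exact ENNReal.toReal_mono (Lp.memLp g).2.ne
    (eLpNorm_le_eLpNorm_of_exponent_le (by norm_num) h1.1)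

theorem integrable_Lp_two (g : Lp 𝕜 2 unitMeasure) : Integrable g unitMeasure :=
  (Lp.memLp g).integrable (by norm_num)

theorem integrable_kernel_smul {κ : ℝ → ℝ → ℝ} (hκ : Continuous (Function.uncurry κ)) {t : ℝ}
    (g : Lp 𝕜 2 unitMeasure) : Integrable (fun s => κ t s • g s) unitMeasure := by
  have hc : Continuous (κ t) := hκ.comp (Continuous.prodMk_right t)
  obtain ⟨C, hC⟩ := (isCompact_Icc (a := (0 : ℝ)) (b := 1)).exists_bound_of_continuousOn
    hc.continuousOn
  refine (integrable_Lp_two g).bdd_smul C hc.aestronglyMeasurable ?_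
  filter_upwards [ae_restrict_mem measurableSet_Ioo] with s hs
  exact hC s (Ioo_subset_Icc_self hs)

theorem norm_integral_kernel_le {κ : ℝ → ℝ → ℝ} {C t : ℝ}
    (hC : ∀ s ∈ Ioo (0 : ℝ) 1, |κ t s| ≤ C) (g : Lp 𝕜 2 unitMeasure) :
    ‖∫ s, κ t s • g s ∂unitMeasure‖ ≤ C * ‖g‖ := by
  have hC0 : 0 ≤ C := (abs_nonneg _).trans (hC (1 / 2) (by norm_num))
  calc ‖∫ s, κ t s • g s ∂unitMeasure‖ ≤ ∫ s, C * ‖g s‖ ∂unitMeasure := by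
        refine norm_integral_le_of_norm_le ((integrable_Lp_two g).norm.const_mul C) ?_
        filter_upwards [ae_restrict_mem measurableSet_Ioo] with s hs
        rw [norm_smul, Real.norm_eq_abs]
        exact mul_le_mul_of_nonneg_right (hC s hs) (norm_nonneg _)
    _ ≤ C * ‖g‖ := by
        rw [integral_const_mul]
        exact mul_le_mul_of_nonneg_left (integral_norm_le_norm_Lp_two g) hC0

theorem exists_bound_kernel {κ : ℝ → ℝ → ℝ} (hκ : Continuous (Function.uncurry κ)) :
    ∃ C, ∀ t ∈ Icc (0 : ℝ) 1, ∀ s ∈ Icc (0 : ℝ) 1, |κ t s| ≤ C := by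
  obtain ⟨C, hC⟩ := ((isCompact_Icc (a := (0 : ℝ)) (b := 1)).prod
    (isCompact_Icc (a := (0 : ℝ)) (b := 1))).exists_bound_of_continuousOn hκ.continuousOn
  exact ⟨C, fun t ht s hs => hC (t, s) ⟨ht, hs⟩⟩

theorem continuous_integral_kernel {κ : ℝ → ℝ → ℝ} (hκ : Continuous (Function.uncurry κ))
    (g : Lp 𝕜 2 unitMeasure) : Continuous fun t => ∫ s, κ t s • g s ∂unitMeasure := by
  rw [continuous_iff_continuousAt]
  intro t₀
  obtain ⟨C, hC⟩ := ((isCompact_Icc (a := t₀ - 1) (b := t₀ + 1)).prod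
    (isCompact_Icc (a := (0 : ℝ)) (b := 1))).exists_bound_of_continuousOn hκ.continuousOn
  refine continuousAt_of_dominated (bound := fun s => C * ‖g s‖)
    (Eventually.of_forall fun t => (integrable_kernel_smul hκ g).1) ?_
    ((integrable_Lp_two g).norm.const_mul C) ?_
  · filter_upwards [Icc_mem_nhds (sub_one_lt t₀) (lt_add_one t₀)] with t ht
    filter_upwards [ae_restrict_mem measurableSet_Ioo] with s hs
    rw [norm_smul]
    exact mul_le_mul_of_nonneg_right (hC (t, s) ⟨ht, Ioo_subset_Icc_self hs⟩) (norm_nonneg _)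
  · refine Eventually.of_forall fun s => ?_
    have hc : Continuous fun t => κ t s := hκ.comp (Continuous.prodMk_left s)
    exact (hc.smul continuous_const).continuousAt

theorem memLp_of_continuousOn_unit {y : ℝ → 𝕜} (hy : ContinuousOn y (Icc 0 1)) {p : ENNReal} :
    MemLp y p unitMeasure := by
  obtain ⟨C, hC⟩ := (isCompact_Icc (a := (0 : ℝ)) (b := 1)).exists_bound_of_continuousOn hy
  refine MemLp.of_bound ((hy.mono Ioo_subset_Icc_self).aestronglyMeasurable measurableSet_Ioo) C ?_
  filter_upwards [ae_restrict_mem measurableSet_Ioo] with s hs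
  exact hC s (Ioo_subset_Icc_self hs)

theorem exists_isKernelOp {κ : ℝ → ℝ → ℝ} (hκ : Continuous (Function.uncurry κ)) :
    ∃ A : Lp 𝕜 2 unitMeasure →L[𝕜] Lp 𝕜 2 unitMeasure, IsKernelOp A κ := by
  obtain ⟨C, hC⟩ := exists_bound_kernel hκ
  have hmem : ∀ g : Lp 𝕜 2 unitMeasure,
      MemLp (fun t => ∫ s, κ t s • g s ∂unitMeasure) 2 unitMeasure := fun g =>
    memLp_of_continuousOn_unit (continuous_integral_kernel hκ g).continuousOn
  let T : Lp 𝕜 2 unitMeasure →ₗ[𝕜] Lp 𝕜 2 unitMeasure :=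
    { toFun := fun g => (hmem g).toLp _
      map_add' := by
        intro g h
        rw [← MemLp.toLp_add, MemLp.toLp_eq_toLp_iff]
        refine Eventually.of_forall fun t => ?_
        rw [Pi.add_apply, ← integral_add (integrable_kernel_smul hκ g) (integrable_kernel_smul hκ h)]
        refine integral_congr_ae ?_
        filter_upwards [Lp.coeFn_add g h] with s hs
        simp only [hs, Pi.add_apply, smul_add]
      map_smul' := by
        intro c g
        rw [RingHom.id_apply, ← MemLp.toLp_const_smul, MemLp.toLp_eq_toLp_iff]
        refine Eventually.of_forall fun t => ?_
        rw [Pi.smul_apply, ← integral_smul]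
        refine integral_congr_ae ?_
        filter_upwards [Lp.coeFn_smul c g] with s hs
        simp only [hs, Pi.smul_apply]
        exact smul_comm _ _ _ }
  refine ⟨T.mkContinuous C fun g => ?_, fun g => (hmem g).coeFn_toLp⟩
  -- The interval has mass one, so a pointwise bound is also a bound of the `L₂` norm.
  refine (Lp.norm_le_of_ae_bound (C := C * ‖g‖)
    (mul_nonneg ((abs_nonneg _).trans (hC 0 (by simp) 0 (by simp))) (norm_nonneg _)) ?_).trans
    (by simp [measureUnivNNReal])
  filter_upwards [(hmem g).coeFn_toLp, ae_restrict_mem measurableSet_Ioo] with t ht htm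
  rw [show T g = (hmem g).toLp _ from rfl, ht]
  exact norm_integral_kernel_le
    (fun s hs => hC t (Ioo_subset_Icc_self htm) s (Ioo_subset_Icc_self hs)) g

/-- On a probability space `|A g(t)| ≤ C ‖g‖₁ ≤ C ‖g‖₂`, so the supremum of the kernel bounds the
operator norm with no further constant. Both the compactness argument and the bound `1/2` for the
deviating problem rest on this. -/
theorem IsKernelOp.norm_le {A : Lp 𝕜 2 unitMeasure →L[𝕜] Lp 𝕜 2 unitMeasure} {κ : ℝ → ℝ → ℝ}
    (hA : IsKernelOp A κ) {C : ℝ}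
    (hC : ∀ t ∈ Ioo (0 : ℝ) 1, ∀ s ∈ Ioo (0 : ℝ) 1, |κ t s| ≤ C) : ‖A‖ ≤ C := by
  have hC0 : 0 ≤ C := (abs_nonneg _).trans (hC (1 / 2) (by norm_num) (1 / 2) (by norm_num))
  refine A.opNorm_le_bound hC0 fun g => ?_
  refine (Lp.norm_le_of_ae_bound (C := C * ‖g‖) (mul_nonneg hC0 (norm_nonneg _)) ?_).trans
    (by simp [measureUnivNNReal])
  filter_upwards [hA g, ae_restrict_mem measurableSet_Ioo] with t ht htm
  rw [ht]
  exact norm_integral_kernel_le (hC t htm) g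

theorem IsKernelOp.sub {A B : Lp 𝕜 2 unitMeasure →L[𝕜] Lp 𝕜 2 unitMeasure} {κ ρ : ℝ → ℝ → ℝ}
    (hA : IsKernelOp A κ) (hB : IsKernelOp B ρ) (hκ : Continuous (Function.uncurry κ))
    (hρ : Continuous (Function.uncurry ρ)) : IsKernelOp (A - B) fun t s => κ t s - ρ t s := by
  intro g
  rw [sub_apply]
  filter_upwards [Lp.coeFn_sub (A g) (B g), hA g, hB g] with t h hA hB
  rw [h, Pi.sub_apply, hA, hB,
    ← integral_sub (integrable_kernel_smul hκ g) (integrable_kernel_smul hρ g)]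
  simp only [sub_smul]

theorem IsKernelOp.add {A B : Lp 𝕜 2 unitMeasure →L[𝕜] Lp 𝕜 2 unitMeasure} {κ ρ : ℝ → ℝ → ℝ}
    (hA : IsKernelOp A κ) (hB : IsKernelOp B ρ) (hκ : Continuous (Function.uncurry κ))
    (hρ : Continuous (Function.uncurry ρ)) : IsKernelOp (A + B) fun t s => κ t s + ρ t s := by
  intro g
  rw [add_apply]
  filter_upwards [Lp.coeFn_add (A g) (B g), hA g, hB g] with t h hA hB
  rw [h, Pi.add_apply, hA, hB,
    ← integral_add (integrable_kernel_smul hκ g) (integrable_kernel_smul hρ g)]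
  simp only [add_smul]

theorem inner_toLp_left {v : ℝ → 𝕜} (hv : MemLp v 2 unitMeasure) (g : Lp 𝕜 2 unitMeasure) :
    inner 𝕜 (hv.toLp v) g = ∫ t, g t * (starRingEnd 𝕜) (v t) ∂unitMeasure := by
  rw [L2.inner_def]
  refine integral_congr_ae ?_
  filter_upwards [hv.coeFn_toLp] with t ht
  rw [ht, RCLike.inner_apply]

/-- The operator of rank one with kernel `a(t) b(s)`. -/
theorem exists_isKernelOp_mul {a b : ℝ → ℝ} (ha : Continuous a) (hb : Continuous b) :
    ∃ (A : Lp 𝕜 2 unitMeasure →L[𝕜] Lp 𝕜 2 unitMeasure) (l : Lp 𝕜 2 unitMeasure →L[𝕜] 𝕜),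
      IsKernelOp A (fun t s => a t * b s) ∧ IsCompactOperator A ∧ ∀ g, l g = 0 → A g = 0 := by
  have ha' : MemLp (fun t => (a t : 𝕜)) 2 unitMeasure :=
    memLp_of_continuousOn_unit (RCLike.continuous_ofReal.comp ha).continuousOn
  have hb' : MemLp (fun t => (b t : 𝕜)) 2 unitMeasure :=
    memLp_of_continuousOn_unit (RCLike.continuous_ofReal.comp hb).continuousOn
  -- The functional is kept because its kernel is the hyperplane of the min-max argument.
  let l : Lp 𝕜 2 unitMeasure →L[𝕜] 𝕜 := innerSL 𝕜 (hb'.toLp _)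
  refine ⟨l.smulRight (ha'.toLp _), l, fun g => ?_, ?_, fun g hg => by simp [hg]⟩
  · rw [ContinuousLinearMap.smulRight_apply]
    filter_upwards [Lp.coeFn_smul (l g) (ha'.toLp _), ha'.coeFn_toLp] with t h1 h2
    rw [h1, Pi.smul_apply, h2, show l g = inner 𝕜 (hb'.toLp _) g from rfl, inner_toLp_left,
      smul_eq_mul, mul_comm, ← integral_const_mul]
    refine integral_congr_ae (Eventually.of_forall fun s => ?_)
    simp only [RCLike.conj_ofReal, RCLike.real_smul_eq_coe_mul, RCLike.ofReal_mul]
    ring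
  · have : IsCompactOperator l := isCompactOperator_of_locallyCompactSpace_dom l
    exact this.clm_comp ((ContinuousLinearMap.id 𝕜 𝕜).smulRight (ha'.toLp _))

end KernelOperators

/-! ### Compactness and symmetry for kernels `h(t + s - 1)`. -/

section HankelKernels

variable {𝕜 : Type*} [RCLike 𝕜]

theorem continuous_uncurry_hankel {h : ℝ → ℝ} (hh : Continuous h) :
    Continuous (Function.uncurry fun t s : ℝ => h (t + s - 1)) := by
  simp only [Function.uncurry_def]
  fun_prop

/-- Writing `t + s - 1 = t + (s - 1)` splits one factor off the power, and each summand is absorbed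
into `a` or into `b`. The induction therefore has to range over all `a` and `b`; it ends in rank-one
kernels. -/
theorem exists_isCompactOperator_mul_pow (n : ℕ) : ∀ a b : ℝ → ℝ, Continuous a → Continuous b →
    ∃ A : Lp 𝕜 2 unitMeasure →L[𝕜] Lp 𝕜 2 unitMeasure,
      IsKernelOp A (fun t s => a t * b s * (t + s - 1) ^ n) ∧ IsCompactOperator A := by
  induction n with
  | zero =>
    intro a b ha hb
    obtain ⟨A, _, hA, hc, _⟩ := exists_isKernelOp_mul (𝕜 := 𝕜) ha hb
    exact ⟨A, by simpa using hA, hc⟩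
  | succ n ih =>
    intro a b ha hb
    obtain ⟨A, hA, hAc⟩ := ih (fun t => a t * t) b (by fun_prop) hb
    obtain ⟨B, hB, hBc⟩ := ih a (fun s => b s * (s - 1)) ha (by fun_prop)
    refine ⟨A + B, ?_, hAc.add hBc⟩
    convert hA.add hB (by simp only [Function.uncurry_def]; fun_prop)
      (by simp only [Function.uncurry_def]; fun_prop) using 3
    ring

theorem exists_isCompactOperator_polynomial (p : Polynomial ℝ) :
    ∃ A : Lp 𝕜 2 unitMeasure →L[𝕜] Lp 𝕜 2 unitMeasure,
      IsKernelOp A (fun t s => p.eval (t + s - 1)) ∧ IsCompactOperator A := by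
  induction p using Polynomial.induction_on' with
  | add p q hp hq =>
    obtain ⟨A, hA, hAc⟩ := hp
    obtain ⟨B, hB, hBc⟩ := hq
    refine ⟨A + B, ?_, hAc.add hBc⟩
    simpa using hA.add hB (continuous_uncurry_hankel p.continuous)
      (continuous_uncurry_hankel q.continuous)
  | monomial n a =>
    obtain ⟨A, hA, hAc⟩ := exists_isCompactOperator_mul_pow (𝕜 := 𝕜) n (fun _ => a) (fun _ => 1)
      continuous_const continuous_const
    exact ⟨A, by simpa using hA, hAc⟩

/-- By Weierstrass `h` is a uniform limit of polynomials on `[-1, 1]`, the range of `t + s - 1`.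
Uniform closeness of kernels gives closeness in operator norm, and compact operators form a closed
set. -/
theorem IsKernelOp.isCompactOperator_hankel {h : ℝ → ℝ} (hh : Continuous h)
    {A : Lp 𝕜 2 unitMeasure →L[𝕜] Lp 𝕜 2 unitMeasure}
    (hA : IsKernelOp A fun t s => h (t + s - 1)) : IsCompactOperator A := by
  have hcl := isClosed_setOfPred_isCompactOperator (σ₁₂ := RingHom.id 𝕜)
    (M₁ := Lp 𝕜 2 unitMeasure) (M₂ := Lp 𝕜 2 unitMeasure)
  refine hcl.closure_subset (Metric.mem_closure_iff.2 fun ε hε => ?_)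
  obtain ⟨p, hp⟩ := exists_polynomial_near_of_continuousOn (-1) 1 h hh.continuousOn (ε / 2)
    (half_pos hε)
  obtain ⟨B, hB, hBc⟩ := exists_isCompactOperator_polynomial (𝕜 := 𝕜) p
  refine ⟨B, hBc, ?_⟩
  rw [dist_eq_norm]
  refine lt_of_le_of_lt ((hA.sub hB (continuous_uncurry_hankel hh)
    (continuous_uncurry_hankel p.continuous)).norm_le (C := ε / 2) fun t ht s hs => ?_)
    (half_lt_self hε)
  rw [abs_sub_comm]
  exact (hp (t + s - 1) ⟨by linarith [ht.1, hs.1], by linarith [ht.2, hs.2]⟩).le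

/-- The kernel is real and invariant under exchanging `t` and `s`, so Fubini suffices. -/
theorem IsKernelOp.isSymmetric_hankel {h : ℝ → ℝ} (hh : Continuous h)
    {A : Lp 𝕜 2 unitMeasure →L[𝕜] Lp 𝕜 2 unitMeasure}
    (hA : IsKernelOp A fun t s => h (t + s - 1)) : (A : Lp 𝕜 2 unitMeasure →ₗ[𝕜] _).IsSymmetric := by
  intro f g
  change inner 𝕜 (A f) g = inner 𝕜 f (A g)
  rw [L2.inner_def, L2.inner_def]
  have h1 : ∫ t, inner 𝕜 (A f t) (g t) ∂unitMeasure =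
      ∫ t, ∫ s, (h (t + s - 1) : 𝕜) * (g t * (starRingEnd 𝕜) (f s)) ∂unitMeasure ∂unitMeasure := by
    refine integral_congr_ae ?_
    filter_upwards [hA f] with t ht
    rw [ht, RCLike.inner_apply, ← integral_conj, ← integral_const_mul]
    refine integral_congr_ae (Eventually.of_forall fun s => ?_)
    simp only [RCLike.real_smul_eq_coe_mul, map_mul, RCLike.conj_ofReal]
    ring
  have h2 : ∫ t, inner 𝕜 (f t) (A g t) ∂unitMeasure =
      ∫ t, ∫ s, (h (t + s - 1) : 𝕜) * (g s * (starRingEnd 𝕜) (f t)) ∂unitMeasure ∂unitMeasure := by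
    refine integral_congr_ae ?_
    filter_upwards [hA g] with t ht
    rw [ht, RCLike.inner_apply, ← integral_mul_const]
    refine integral_congr_ae (Eventually.of_forall fun s => ?_)
    simp only [RCLike.real_smul_eq_coe_mul]
    ring
  rw [h1, h2, integral_integral_swap]
  · simp only [add_comm]
  · obtain ⟨C, hC⟩ := exists_bound_kernel (continuous_uncurry_hankel hh)
    have hc : Integrable (fun s => (starRingEnd 𝕜) (f s)) unitMeasure :=
      (RCLike.conjLIE (K := 𝕜)).toContinuousLinearEquiv.toContinuousLinearMap.integrable_comp
        (integrable_Lp_two f)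
    refine ((integrable_Lp_two g).mul_prod hc).bdd_mul (c := C) ?_ ?_
    · exact (RCLike.continuous_ofReal.comp
        (continuous_uncurry_hankel hh)).aestronglyMeasurable
    · rw [Measure.prod_restrict]
      filter_upwards [ae_restrict_mem (measurableSet_Ioo.prod measurableSet_Ioo)] with p hp
      simpa using hC p.1 (Ioo_subset_Icc_self hp.1) p.2 (Ioo_subset_Icc_self hp.2)

end HankelKernels

/-! ### Zero Cauchy data, Green's identity and Duhamel's formula on `[0, 1]`. -/

section CauchyProblem

variable {𝕜 : Type*} [RCLike 𝕜]

/-- `y` is of class `C²` on `[0, 1]` with derivatives `y₁`, `y₂`, and `y(0) = y'(0) = 0`. -/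
structure HasZeroCauchyData (y y₁ y₂ : ℝ → 𝕜) : Prop where
  deriv : ∀ t ∈ Icc (0 : ℝ) 1, HasDerivWithinAt y (y₁ t) (Icc 0 1) t
  deriv₁ : ∀ t ∈ Icc (0 : ℝ) 1, HasDerivWithinAt y₁ (y₂ t) (Icc 0 1) t
  continuousOn₂ : ContinuousOn y₂ (Icc 0 1)
  zero : y 0 = 0
  zero₁ : y₁ 0 = 0

namespace HasZeroCauchyData

variable {y y₁ y₂ z z₁ z₂ : ℝ → 𝕜}

theorem continuousOn (h : HasZeroCauchyData y y₁ y₂) : ContinuousOn y (Icc 0 1) :=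
  fun t ht => (h.deriv t ht).continuousWithinAt

theorem continuousOn₁ (h : HasZeroCauchyData y y₁ y₂) : ContinuousOn y₁ (Icc 0 1) :=
  fun t ht => (h.deriv₁ t ht).continuousWithinAt

theorem hasDerivAt (h : HasZeroCauchyData y y₁ y₂) {t : ℝ} (ht : t ∈ Ioo (0 : ℝ) 1) :
    HasDerivAt y (y₁ t) t :=
  (h.deriv t (Ioo_subset_Icc_self ht)).hasDerivAt (Icc_mem_nhds ht.1 ht.2)

theorem hasDerivAt₁ (h : HasZeroCauchyData y y₁ y₂) {t : ℝ} (ht : t ∈ Ioo (0 : ℝ) 1) :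
    HasDerivAt y₁ (y₂ t) t :=
  (h.deriv₁ t (Ioo_subset_Icc_self ht)).hasDerivAt (Icc_mem_nhds ht.1 ht.2)

theorem iteratedDeriv_two (h : HasZeroCauchyData y y₁ y₂) {t : ℝ} (ht : t ∈ Ioo (0 : ℝ) 1) :
    iteratedDeriv 2 y t = y₂ t := by
  rw [iteratedDeriv_succ, iteratedDeriv_one]
  have : _root_.deriv y =ᶠ[𝓝 t] y₁ := by
    filter_upwards [Ioo_mem_nhds ht.1 ht.2] with s hs
    exact (h.hasDerivAt hs).deriv
  rw [this.deriv_eq]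
  exact (h.hasDerivAt₁ ht).deriv

theorem conj (h : HasZeroCauchyData y y₁ y₂) : HasZeroCauchyData (fun t => (starRingEnd 𝕜) (y t))
    (fun t => (starRingEnd 𝕜) (y₁ t)) (fun t => (starRingEnd 𝕜) (y₂ t)) where
  deriv t ht := (h.deriv t ht).star
  deriv₁ t ht := (h.deriv₁ t ht).star
  continuousOn₂ := RCLike.continuous_conj.comp_continuousOn h.continuousOn₂
  zero := by simp [h.zero]
  zero₁ := by simp [h.zero₁]

theorem of_contDiffOn (hy : ContDiffOn ℝ 2 y (Icc 0 1)) (h0 : y 0 = 0)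
    (h1 : HasDerivWithinAt y 0 (Icc 0 1) 0) : ∃ y₁ y₂, HasZeroCauchyData y y₁ y₂ := by
  have hu : UniqueDiffOn ℝ (Icc (0 : ℝ) 1) := uniqueDiffOn_Icc one_pos
  rw [show (2 : WithTop ℕ∞) = 1 + 1 by norm_num, contDiffOn_succ_iff_derivWithin hu] at hy
  obtain ⟨hd, -, hd1⟩ := hy
  have hd2 := (contDiffOn_one_iff_derivWithin hu).1 hd1
  exact ⟨derivWithin y (Icc 0 1), derivWithin (derivWithin y (Icc 0 1)) (Icc 0 1),
    fun t ht => (hd t ht).hasDerivWithinAt, fun t ht => (hd2.1 t ht).hasDerivWithinAt, hd2.2, h0,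
    h1.derivWithin (hu 0 (by simp))⟩

theorem contDiffOn (h : HasZeroCauchyData y y₁ y₂) : ContDiffOn ℝ 2 y (Icc 0 1) := by
  have hu : UniqueDiffOn ℝ (Icc (0 : ℝ) 1) := uniqueDiffOn_Icc one_pos
  have h1 : ∀ t ∈ Icc (0 : ℝ) 1, derivWithin y (Icc 0 1) t = y₁ t :=
    fun t ht => (h.deriv t ht).derivWithin (hu t ht)
  rw [show (2 : WithTop ℕ∞) = 1 + 1 by norm_num, contDiffOn_succ_iff_derivWithin hu]
  refine ⟨fun t ht => (h.deriv t ht).differentiableWithinAt, by simp, ?_⟩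
  refine ContDiffOn.congr ?_ h1
  refine (contDiffOn_one_iff_derivWithin hu).2
    ⟨fun t ht => (h.deriv₁ t ht).differentiableWithinAt, h.continuousOn₂.congr fun t ht => ?_⟩
  exact (h.deriv₁ t ht).derivWithin (hu t ht)

theorem one_sub_mem_Icc {t : ℝ} (ht : t ∈ Icc (0 : ℝ) 1) : 1 - t ∈ Icc (0 : ℝ) 1 :=
  ⟨by linarith [ht.2], by linarith [ht.1]⟩

theorem one_sub_mem_Ioo {t : ℝ} (ht : t ∈ Ioo (0 : ℝ) 1) : 1 - t ∈ Ioo (0 : ℝ) 1 :=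
  ⟨by linarith [ht.2], by linarith [ht.1]⟩

theorem continuousOn_comp_one_sub {g : ℝ → 𝕜} (hg : ContinuousOn g (Icc 0 1)) :
    ContinuousOn (fun t => g (1 - t)) (Icc 0 1) :=
  hg.comp (by fun_prop) fun _ ht => one_sub_mem_Icc ht

/-- Green's identity for `d²/dt² - μ` composed with the reflection `t ↦ 1 - t`. -/
theorem green (hy : HasZeroCauchyData y y₁ y₂) (hz : HasZeroCauchyData z z₁ z₂) (μ : 𝕜) :
    ∫ t in (0 : ℝ)..1, (y₂ (1 - t) - μ * y (1 - t)) * z t =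
      ∫ t in (0 : ℝ)..1, y (1 - t) * (z₂ t - μ * z t) := by
  have hi : ∀ {g : ℝ → 𝕜}, ContinuousOn g (Icc 0 1) → IntervalIntegrable g volume 0 1 :=
    fun hg => ContinuousOn.intervalIntegrable (by rwa [uIcc_of_le zero_le_one])
  have c0 := continuousOn_comp_one_sub hy.continuousOn
  have c1 := continuousOn_comp_one_sub hy.continuousOn₁
  have c2 := continuousOn_comp_one_sub hy.continuousOn₂
  have d0 := hz.continuousOn
  have d1 := hz.continuousOn₁
  have d2 := hz.continuousOn₂
  have k1 : ContinuousOn (fun t => y (1 - t) * (z₂ t - μ * z t)) (Icc 0 1) :=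
    c0.mul (d2.sub (continuousOn_const.mul d0))
  have k2 : ContinuousOn (fun t => (y₂ (1 - t) - μ * y (1 - t)) * z t) (Icc 0 1) :=
    (c2.sub (continuousOn_const.mul c0)).mul d0
  -- The integrand is the derivative of `y₁(1 - t) z(t) + y(1 - t) z₁(t)`: the terms with `μ`
  -- cancel, and so do the products of first derivatives. At `t = 1` the data of `y` at `0` appear,
  -- at `t = 0` those of `z`.
  have key : ∫ t in (0 : ℝ)..1, (y (1 - t) * (z₂ t - μ * z t) -
      (y₂ (1 - t) - μ * y (1 - t)) * z t) =
      (y₁ (1 - 1) * z 1 + y (1 - 1) * z₁ 1) - (y₁ (1 - 0) * z 0 + y (1 - 0) * z₁ 0) := by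
    refine intervalIntegral.integral_eq_sub_of_hasDerivAt_of_le
      (f := fun t => y₁ (1 - t) * z t + y (1 - t) * z₁ t) zero_le_one
      ((c1.mul d0).add (c0.mul d1)) (fun t ht => ?_) (hi (k1.sub k2))
    have e0 := (hy.hasDerivAt (one_sub_mem_Ioo ht)).scomp t ((hasDerivAt_id t).const_sub 1)
    have e1 := (hy.hasDerivAt₁ (one_sub_mem_Ioo ht)).scomp t ((hasDerivAt_id t).const_sub 1)
    refine ((e1.mul (hz.hasDerivAt ht)).add (e0.mul (hz.hasDerivAt₁ ht))).congr_deriv ?_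
    simp only [Function.comp_apply, neg_smul, one_smul]
    ring
  rw [intervalIntegral.integral_sub (hi k1) (hi k2), sub_self, hy.zero,
    hy.zero₁, hz.zero, hz.zero₁] at key
  simp only [zero_mul, mul_zero, add_zero, sub_zero] at key
  exact (sub_eq_zero.1 key).symm

end HasZeroCauchyData

/-- The fundamental solution of `d²/dt² - a²`, extended by zero to the negative axis. -/
noncomputable def fundSol (a r : ℝ) : ℝ := (Real.exp (a * r) - Real.exp (-(a * |r|))) / (2 * a)

theorem continuous_fundSol (a : ℝ) : Continuous (fundSol a) := by
  unfold fundSol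
  fun_prop

theorem fundSol_of_nonneg (a : ℝ) {r : ℝ} (hr : 0 ≤ r) : fundSol a r = Real.sinh (a * r) / a := by
  rw [fundSol, abs_of_nonneg hr, Real.sinh_eq, div_div]

theorem fundSol_of_nonpos (a : ℝ) {r : ℝ} (hr : r ≤ 0) : fundSol a r = 0 := by
  rw [fundSol, abs_of_nonpos hr, mul_neg, neg_neg, sub_self, zero_div]

/-- After `s ↦ 1 - s` the kernel becomes `fundSol a (t - s)`, which vanishes for `s > t`. Thus the
symmetric kernel applied to reflected data is the Volterra operator of Duhamel's formula. -/
theorem integral_fundSol_eq_volterra (a : ℝ) {h : ℝ → 𝕜} (hh : ContinuousOn h (Icc 0 1)) {t : ℝ}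
    (ht : t ∈ Icc (0 : ℝ) 1) :
    ∫ s in (0 : ℝ)..1, fundSol a (t + s - 1) • h (1 - s) =
      ∫ s in (0 : ℝ)..t, (Real.sinh (a * (t - s)) / a) • h s := by
  have hc : ContinuousOn (fun s => fundSol a (t - s) • h s) (Icc 0 1) :=
    ((continuous_fundSol a).comp (by fun_prop)).continuousOn.smul hh
  have e1 : ∫ s in (0 : ℝ)..1, fundSol a (t + s - 1) • h (1 - s) =
      ∫ s in (0 : ℝ)..1, fundSol a (t - s) • h s := by
    have := intervalIntegral.integral_comp_sub_left (a := 0) (b := 1)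
      (fun s => fundSol a (t - s) • h s) 1
    rw [sub_self, sub_zero] at this
    rw [← this]
    congr! 3
    ring_nf
  rw [e1, ← intervalIntegral.integral_add_adjacent_intervals (b := t)]
  · have e2 : ∫ s in t..1, fundSol a (t - s) • h s = 0 := by
      rw [← intervalIntegral.integral_zero (a := t) (b := 1)]
      refine intervalIntegral.integral_congr fun s hs => ?_
      rw [uIcc_of_le ht.2] at hs
      simp only [fundSol_of_nonpos a (sub_nonpos.2 hs.1), zero_smul]
    rw [e2, add_zero]
    refine intervalIntegral.integral_congr fun s hs => ?_
    rw [uIcc_of_le ht.1] at hs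
    simp only [fundSol_of_nonneg a (sub_nonneg.2 hs.2)]
  · refine (hc.mono ?_).intervalIntegrable
    rw [uIcc_of_le ht.1]
    exact Icc_subset_Icc_right ht.2
  · refine (hc.mono ?_).intervalIntegrable
    rw [uIcc_of_le ht.2]
    exact Icc_subset_Icc_left ht.1

/-- Duhamel's formula for the Cauchy problem `y'' - a² y = h`, `y(0) = y'(0) = 0`. -/
theorem HasZeroCauchyData.eq_integral_fundSol {y y₁ y₂ : ℝ → 𝕜} (hy : HasZeroCauchyData y y₁ y₂)
    {a : ℝ} (ha : a ≠ 0) {t : ℝ} (ht : t ∈ Icc (0 : ℝ) 1) :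
    y t = ∫ s in (0 : ℝ)..1, fundSol a (t + s - 1) • (y₂ (1 - s) - a ^ 2 • y (1 - s)) := by
  have hc : ContinuousOn (fun s => y₂ s - a ^ 2 • y s) (Icc 0 1) :=
    hy.continuousOn₂.sub (hy.continuousOn.const_smul _)
  rw [integral_fundSol_eq_volterra a hc ht]
  have hsub : Icc 0 t ⊆ Icc (0 : ℝ) 1 := Icc_subset_Icc_right ht.2
  have c0 := hy.continuousOn.mono hsub
  have c1 := hy.continuousOn₁.mono hsub
  -- In the derivative of this antiderivative the terms with `cosh · y₁` cancel. Its value at `s =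
  -- t` is `y(t)`, and at `s = 0` it vanishes by the Cauchy data.
  have hint := intervalIntegral.integral_eq_sub_of_hasDerivAt_of_le (a := 0) (b := t)
    (f := fun s => (Real.sinh (a * (t - s)) / a) • y₁ s + Real.cosh (a * (t - s)) • y s)
    (f' := fun s => (Real.sinh (a * (t - s)) / a) • (y₂ s - a ^ 2 • y s)) ht.1 ?_ ?_ ?_
  · rw [hint]
    simp [hy.zero, hy.zero₁]
  · exact ((by fun_prop : Continuous fun s => Real.sinh (a * (t - s)) / a).continuousOn.smul c1).add
      ((by fun_prop : Continuous fun s => Real.cosh (a * (t - s))).continuousOn.smul c0)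
  · intro s hs
    have hs' : s ∈ Ioo (0 : ℝ) 1 := ⟨hs.1, hs.2.trans_le ht.2⟩
    have l : HasDerivAt (fun s => a * (t - s)) (a * (-1)) s :=
      ((hasDerivAt_id s).const_sub t).const_mul a
    refine (((l.sinh.div_const a).smul (hy.hasDerivAt₁ hs')).add
      (l.cosh.smul (hy.hasDerivAt hs'))).congr_deriv ?_
    have e1 : Real.cosh (a * (t - s)) * (a * -1) / a = - Real.cosh (a * (t - s)) := by
      field_simp
    have e2 : Real.sinh (a * (t - s)) * (a * -1) = - (Real.sinh (a * (t - s)) / a * a ^ 2) := by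
      field_simp
    rw [e1, e2]
    module
  · refine ContinuousOn.intervalIntegrable ?_
    rw [uIcc_of_le ht.1]
    exact (by fun_prop : Continuous fun s => Real.sinh (a * (t - s)) / a).continuousOn.smul
      (hc.mono hsub)

/-- Duhamel's formula gives a solution of the Cauchy problem. -/
theorem hasZeroCauchyData_integral_fundSol {a : ℝ} (ha : a ≠ 0) {h : ℝ → 𝕜} (hh : Continuous h) :
    ∃ y y₁ : ℝ → 𝕜, HasZeroCauchyData y y₁ (fun t => a ^ 2 • y t + h t) ∧
      ∀ t ∈ Icc (0 : ℝ) 1, y t = ∫ s in (0 : ℝ)..1, fundSol a (t + s - 1) • h (1 - s) := by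
  -- The addition formula for `sinh (a * (t - s))` separates `t` from `s`, so that `t` enters the
  -- integrals only through their upper limits and the product rule applies.
  set C : ℝ → 𝕜 := fun t => ∫ s in (0 : ℝ)..t, Real.cosh (a * s) • h s with hC
  set S : ℝ → 𝕜 := fun t => ∫ s in (0 : ℝ)..t, Real.sinh (a * s) • h s with hS
  have hcc : Continuous fun s => Real.cosh (a * s) • h s := by fun_prop
  have hsc : Continuous fun s => Real.sinh (a * s) • h s := by fun_prop
  have dC : ∀ t, HasDerivAt C (Real.cosh (a * t) • h t) t := fun t =>
    hcc.integral_hasStrictDerivAt 0 t |>.hasDerivAt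
  have dS : ∀ t, HasDerivAt S (Real.sinh (a * t) • h t) t := fun t =>
    hsc.integral_hasStrictDerivAt 0 t |>.hasDerivAt
  have l : ∀ t, HasDerivAt (fun s => a * s) (a * 1) t := fun t => (hasDerivAt_id t).const_mul a
  have dy : ∀ t, HasDerivAt (fun t => (Real.sinh (a * t) / a) • C t - (Real.cosh (a * t) / a) • S t)
      (Real.cosh (a * t) • C t - Real.sinh (a * t) • S t) t := by
    intro t
    refine ((((l t).sinh.div_const a).smul (dC t)).sub
      (((l t).cosh.div_const a).smul (dS t))).congr_deriv ?_
    rw [mul_one, mul_div_cancel_right₀ _ ha, mul_div_cancel_right₀ _ ha]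
    module
  have dy₁ : ∀ t, HasDerivAt (fun t => Real.cosh (a * t) • C t - Real.sinh (a * t) • S t)
      (a ^ 2 • ((Real.sinh (a * t) / a) • C t - (Real.cosh (a * t) / a) • S t) + h t) t := by
    intro t
    refine (((l t).cosh.smul (dC t)).sub ((l t).sinh.smul (dS t))).congr_deriv ?_
    have e1 : a ^ 2 * (Real.sinh (a * t) / a) = Real.sinh (a * t) * a := by field_simp
    have e2 : a ^ 2 * (Real.cosh (a * t) / a) = Real.cosh (a * t) * a := by field_simp
    rw [smul_sub (a ^ 2), smul_smul (a ^ 2), smul_smul (a ^ 2), e1, e2]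
    have e3 := congrArg (· • h t) (Real.cosh_sq (a * t))
    simp only [add_smul, one_smul] at e3
    linear_combination (norm := module) e3
  refine ⟨_, _, ⟨fun t _ => (dy t).hasDerivWithinAt, fun t _ => (dy₁ t).hasDerivWithinAt, ?_, ?_,
    ?_⟩, fun t ht => ?_⟩
  · have : Continuous fun t => (Real.sinh (a * t) / a) • C t - (Real.cosh (a * t) / a) • S t :=
      continuous_iff_continuousAt.2 fun t => (dy t).continuousAt
    exact ((this.const_smul (a ^ 2)).add hh).continuousOn
  · simp [hC, hS]
  · simp [hC, hS]
  · rw [integral_fundSol_eq_volterra a hh.continuousOn ht]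
    simp only [hC, hS]
    rw [← intervalIntegral.integral_smul, ← intervalIntegral.integral_smul,
      ← intervalIntegral.integral_sub]
    · refine intervalIntegral.integral_congr fun s _ => ?_
      simp only [mul_sub, Real.sinh_sub, sub_div, sub_smul, smul_smul]
      congr 2 <;> ring
    · exact (hcc.const_smul _).intervalIntegrable _ _
    · exact (hsc.const_smul _).intervalIntegrable _ _

end CauchyProblem

/-! ### A two-vector min-max estimate. -/

section TwoDimensional

variable {𝕜 H : Type*} [RCLike 𝕜] [NormedAddCommGroup H] [InnerProductSpace 𝕜 H]

/-- Min-max principle: an operator that is bounded by `C` on a hyperplane has at most one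
eigenvalue of modulus greater than `C` within an orthonormal family of eigenvectors. -/
theorem norm_eigenvalue_le_of_le_on_ker {A : H →L[𝕜] H} {l : H →L[𝕜] 𝕜} {C : ℝ}
    (hC : ∀ w, l w = 0 → ‖A w‖ ≤ C * ‖w‖) {x y : H} (hx : ‖x‖ = 1) (hy : ‖y‖ = 1)
    (hxy : inner 𝕜 x y = 0) {p q : 𝕜} (hp : A x = p • x) (hq : A y = q • y) (hqp : ‖q‖ ≤ ‖p‖) :
    ‖q‖ ≤ C := by
  -- The span of the two eigenvectors is two-dimensional, hence meets the hyperplane `l = 0` in a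
  -- nonzero vector. On it `A` has norm at least `‖q‖` times that of the vector.
  obtain ⟨α, β, hne, hl⟩ : ∃ α β : 𝕜, 0 < ‖α‖ ^ 2 + ‖β‖ ^ 2 ∧ l (α • x + β • y) = 0 := by
    by_cases h : l x = 0
    · exact ⟨1, 0, by simp, by simp [h]⟩
    · refine ⟨l y, -l x, ?_, ?_⟩
      · have := norm_pos_iff.2 h
        rw [norm_neg]
        positivity
      · simp only [map_add, map_smul, smul_eq_mul]
        ring
  have hn : ∀ a b : 𝕜, ‖a • x + b • y‖ ^ 2 = ‖a‖ ^ 2 + ‖b‖ ^ 2 := by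
    intro a b
    have := norm_add_sq_eq_norm_sq_add_norm_sq_of_inner_eq_zero (a • x) (b • y)
      (by rw [inner_smul_left, inner_smul_right, hxy, mul_zero, mul_zero] : inner 𝕜 _ _ = 0)
    rw [sq, this, norm_smul, norm_smul, hx, hy]
    ring
  have h1 := hC _ hl
  have hC0 : 0 ≤ C := by
    by_contra h
    have h2 : ‖α • x + β • y‖ ≤ 0 := by nlinarith [norm_nonneg (A (α • x + β • y))]
    have h3 := hn α β
    rw [le_antisymm h2 (norm_nonneg _)] at h3
    linarith
  have h2 := pow_le_pow_left₀ (norm_nonneg _) h1 2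
  rw [map_add, map_smul, map_smul, hp, hq, smul_smul, smul_smul, hn, mul_pow, hn, norm_mul,
    norm_mul] at h2
  have h3 : ‖q‖ ^ 2 ≤ ‖p‖ ^ 2 := pow_le_pow_left₀ (norm_nonneg _) hqp 2
  have h4 : ‖q‖ ^ 2 * (‖α‖ ^ 2 + ‖β‖ ^ 2) ≤ C ^ 2 * (‖α‖ ^ 2 + ‖β‖ ^ 2) := by
    nlinarith [mul_le_mul_of_nonneg_left h3 (sq_nonneg ‖α‖)]
  exact (pow_le_pow_iff_left₀ (norm_nonneg _) hC0 two_ne_zero).1 (le_of_mul_le_mul_right h4 hne)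

end TwoDimensional

/-! ### Eigenvalues and completeness for the deviating problem. -/

section DeviatingProblem

variable {𝕜 : Type*} [RCLike 𝕜]

theorem intervalIntegral_eq_integral_unit (f : ℝ → 𝕜) :
    ∫ t in (0 : ℝ)..1, f t = ∫ t, f t ∂unitMeasure := by
  rw [intervalIntegral.integral_of_le zero_le_one, integral_Ioc_eq_integral_Ioo]

theorem integral_unit_comp_one_sub (f : ℝ → 𝕜) :
    ∫ t, f (1 - t) ∂unitMeasure = ∫ t, f t ∂unitMeasure := by
  rw [← intervalIntegral_eq_integral_unit, ← intervalIntegral_eq_integral_unit,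
    intervalIntegral.integral_comp_sub_left, sub_self, sub_zero]

theorem integral_unit_congr {f g : ℝ → 𝕜} (h : ∀ t ∈ Ioo (0 : ℝ) 1, f t = g t) :
    ∫ t, f t ∂unitMeasure = ∫ t, g t ∂unitMeasure :=
  setIntegral_congr_fun measurableSet_Ioo h

/-- In `fundSol a (t + s - 1)` the growing exponential factorises as `e^{at}` times
`e^{a(s-1)}/(2a)`, so it disappears on a hyperplane. The remaining kernel is at most `1/(2a) ≤ 1/2`
in modulus. -/
theorem exists_deviating_kernelOp {a : ℝ} (ha : 1 ≤ a) :
    ∃ (A : Lp 𝕜 2 unitMeasure →L[𝕜] Lp 𝕜 2 unitMeasure) (l : Lp 𝕜 2 unitMeasure →L[𝕜] 𝕜),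
      IsKernelOp A (fun t s => fundSol a (t + s - 1)) ∧
      ∀ w, l w = 0 → ‖A w‖ ≤ 1 / 2 * ‖w‖ := by
  obtain ⟨R, l, hR, -, hRl⟩ := exists_isKernelOp_mul (𝕜 := 𝕜) (a := fun t => Real.exp (a * t))
    (b := fun s => Real.exp (a * (s - 1)) / (2 * a)) (by fun_prop) (by fun_prop)
  have hBc : Continuous fun r => Real.exp (-(a * |r|)) / (2 * a) := by fun_prop
  obtain ⟨B, hB⟩ := exists_isKernelOp (𝕜 := 𝕜) (continuous_uncurry_hankel hBc)
  refine ⟨R - B, l, ?_, fun w hw => ?_⟩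
  · convert hR.sub hB (by simp only [Function.uncurry_def]; fun_prop)
      (continuous_uncurry_hankel hBc) using 3
    rw [fundSol, sub_div, ← mul_div_assoc, ← Real.exp_add]
    ring_nf
  · rw [sub_apply, hRl w hw, zero_sub, norm_neg]
    refine (B.le_opNorm w).trans (mul_le_mul_of_nonneg_right (hB.norm_le fun t _ s _ => ?_)
      (norm_nonneg _))
    rw [abs_of_nonneg (by positivity)]
    refine div_le_div₀ zero_le_one ?_ two_pos (by linarith)
    exact Real.exp_le_one_iff.2 (neg_nonpos.2 (by positivity))

namespace SolvesDeviating

variable {μ : ℝ} {l : 𝕜} {v : ℝ → 𝕜}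

theorem exists_hasZeroCauchyData (h : SolvesDeviating μ l v) :
    ∃ v₁ v₂, HasZeroCauchyData v v₁ v₂ ∧
      ∀ t ∈ Ioo (0 : ℝ) 1, v₂ t - (μ : 𝕜) * v t = l * v (1 - t) := by
  obtain ⟨v₁, v₂, hd⟩ := HasZeroCauchyData.of_contDiffOn h.contDiffOn h.initial h.initial_deriv
  refine ⟨v₁, v₂, hd, fun t ht => ?_⟩
  rw [← hd.iteratedDeriv_two ht, h.equation t ht]

theorem continuousOn (h : SolvesDeviating μ l v) : ContinuousOn v (Icc 0 1) :=
  h.contDiffOn.continuousOn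

theorem memLp (h : SolvesDeviating μ l v) {p : ENNReal} : MemLp v p unitMeasure :=
  memLp_of_continuousOn_unit h.continuousOn

/-- Green's identity against a solution of the deviating problem. -/
theorem green (h : SolvesDeviating μ l v) {y y₁ y₂ : ℝ → 𝕜} (hy : HasZeroCauchyData y y₁ y₂) :
    ∫ t, (y₂ (1 - t) - (μ : 𝕜) * y (1 - t)) * (starRingEnd 𝕜) (v t) ∂unitMeasure =
      (starRingEnd 𝕜) l * ∫ t, y t * (starRingEnd 𝕜) (v t) ∂unitMeasure := by
  obtain ⟨v₁, v₂, hd, heq⟩ := h.exists_hasZeroCauchyData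
  have := hy.green hd.conj (μ : 𝕜)
  rw [intervalIntegral_eq_integral_unit, intervalIntegral_eq_integral_unit] at this
  rw [this, ← integral_const_mul, ← integral_unit_comp_one_sub (fun t => _ * _)]
  refine integral_unit_congr fun t ht => ?_
  have := congrArg (starRingEnd 𝕜) (heq (1 - t) (HasZeroCauchyData.one_sub_mem_Ioo ht))
  simp only [map_sub, map_mul, RCLike.conj_ofReal, sub_sub_cancel] at this
  rw [this, sub_sub_cancel]
  ring

/-- Green's identity of `v` against itself has `l` on one side, by the equation at `1 - t`, and its
conjugate on the other. -/
theorem conj_eigenvalue (h : SolvesDeviating μ l v)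
    (hv : ∫ t, v t * (starRingEnd 𝕜) (v t) ∂unitMeasure = 1) : (starRingEnd 𝕜) l = l := by
  obtain ⟨v₁, v₂, hd, heq⟩ := h.exists_hasZeroCauchyData
  have h1 := h.green hd
  rw [hv, mul_one] at h1
  rw [← h1, ← mul_one l, ← hv, ← integral_const_mul]
  refine integral_unit_congr fun t ht => ?_
  have := heq (1 - t) (HasZeroCauchyData.one_sub_mem_Ioo ht)
  rw [sub_sub_cancel] at this
  rw [this]
  ring

/-- In Duhamel's formula the source at `1 - s` equals `l v(s)` by the equation, so the deviation of
the argument cancels the reflection. Eigenvalues of the problem are thus reciprocals of eigenvalues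
of `A`. -/
theorem toLp_eq_smul {a : ℝ} (ha : a ≠ 0) (h : SolvesDeviating (a ^ 2) l v)
    {A : Lp 𝕜 2 unitMeasure →L[𝕜] Lp 𝕜 2 unitMeasure}
    (hA : IsKernelOp A fun t s => fundSol a (t + s - 1)) (hm : MemLp v 2 unitMeasure) :
    hm.toLp v = l • A (hm.toLp v) := by
  obtain ⟨v₁, v₂, hd, heq⟩ := h.exists_hasZeroCauchyData
  refine Lp.ext ?_
  filter_upwards [hm.coeFn_toLp, Lp.coeFn_smul l (A (hm.toLp v)),
    hA (hm.toLp v), ae_restrict_mem measurableSet_Ioo] with t h1 h2 h3 ht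
  rw [h2, Pi.smul_apply, h3, h1, hd.eq_integral_fundSol ha (Ioo_subset_Icc_self ht),
    intervalIntegral_eq_integral_unit, ← integral_smul]
  refine integral_congr_ae ?_
  filter_upwards [hm.coeFn_toLp, ae_restrict_mem measurableSet_Ioo] with s hs hs'
  have := heq (1 - s) (HasZeroCauchyData.one_sub_mem_Ioo hs')
  rw [sub_sub_cancel, RCLike.ofReal_pow] at this
  rw [hs, smul_comm l, smul_eq_mul, ← this, RCLike.real_smul_eq_coe_mul (a ^ 2), RCLike.ofReal_pow]

end SolvesDeviating

/-- The integral operator of the deviating problem is injective. -/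
theorem IsKernelOp.eq_zero_of_fundSol {a : ℝ} (ha : a ≠ 0)
    {A : Lp 𝕜 2 unitMeasure →L[𝕜] Lp 𝕜 2 unitMeasure}
    (hA : IsKernelOp A fun t s => fundSol a (t + s - 1)) {g : Lp 𝕜 2 unitMeasure} (hg : A g = 0) :
    g = 0 := by
  refine (Lp.eq_zero_iff_ae_eq_zero).2 ?_
  refine (ae_restrict_iff' measurableSet_Ioo).2 ?_
  refine isOpen_Ioo.ae_eq_zero_of_integral_contDiff_smul_eq_zero
    (IntegrableOn.locallyIntegrableOn (integrable_Lp_two g)) fun φ hφ _ hsupp => ?_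
  have hφ0 : ∀ t ∉ Ioo (0 : ℝ) 1, φ t = 0 := fun t ht =>
    image_eq_zero_of_notMem_tsupport fun h => ht (hsupp h)
  have hφ1 : ContDiff ℝ ∞ (deriv φ) := (contDiff_infty_iff_deriv.1 hφ).2
  have hφ2 : ContDiff ℝ ∞ (deriv (deriv φ)) := (contDiff_infty_iff_deriv.1 hφ1).2
  have hφ10 : deriv φ 0 = 0 := by
    refine image_eq_zero_of_notMem_tsupport fun h => ?_
    exact lt_irrefl _ (hsupp (tsupport_deriv_subset h)).1
  have hd : HasZeroCauchyData (fun t => (φ t : 𝕜)) (fun t => ((deriv φ t : ℝ) : 𝕜))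
      (fun t => ((deriv (deriv φ) t : ℝ) : 𝕜)) := by
    refine ⟨fun t _ => ?_, fun t _ => ?_, ?_, ?_, ?_⟩
    · exact ((RCLike.ofRealCLM (K := 𝕜)).hasFDerivAt.comp_hasDerivAt t
        (hφ.differentiable (by simp) t).hasDerivAt).hasDerivWithinAt
    · exact ((RCLike.ofRealCLM (K := 𝕜)).hasFDerivAt.comp_hasDerivAt t
        (hφ1.differentiable (by simp) t).hasDerivAt).hasDerivWithinAt
    · exact (RCLike.continuous_ofReal.comp hφ2.continuous).continuousOn
    · simp [hφ0 0]
    · simp [hφ10]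
  have hm : MemLp (fun t => (φ t : 𝕜)) 2 unitMeasure := memLp_of_continuousOn_unit hd.continuousOn
  have hψ : MemLp (fun t => ((deriv (deriv φ) (1 - t) : ℝ) : 𝕜) - a ^ 2 • (φ (1 - t) : 𝕜)) 2
      unitMeasure := memLp_of_continuousOn_unit
    ((HasZeroCauchyData.continuousOn_comp_one_sub hd.continuousOn₂).sub
      ((HasZeroCauchyData.continuousOn_comp_one_sub hd.continuousOn).const_smul (a ^ 2)))
  -- By Duhamel every test function `φ` is in the range of `A`, being the image of `ψ(t) = φ''(1 -
  -- t) - a² φ(1 - t)`. Symmetry then gives `(φ, g) = (ψ, A g) = 0`.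
  have hAψ : A (hψ.toLp _) = hm.toLp _ := by
    refine Lp.ext ?_
    filter_upwards [hA (hψ.toLp _), hm.coeFn_toLp, ae_restrict_mem measurableSet_Ioo]
      with t h1 h2 ht
    rw [h1, h2, hd.eq_integral_fundSol ha (Ioo_subset_Icc_self ht),
      intervalIntegral_eq_integral_unit]
    refine integral_congr_ae ?_
    filter_upwards [hψ.coeFn_toLp] with s hs
    rw [hs]
  have h0 : inner 𝕜 (A (hψ.toLp _)) g = 0 := by
    have := hA.isSymmetric_hankel (continuous_fundSol a) (hψ.toLp _) g
    rw [show inner 𝕜 (A (hψ.toLp _)) g = inner 𝕜 (hψ.toLp _) (A g) from this, hg, inner_zero_right]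
  rw [hAψ, inner_toLp_left] at h0
  rw [← h0, ← setIntegral_eq_integral_of_forall_compl_eq_zero (s := Ioo (0 : ℝ) 1)]
  · refine integral_congr_ae (Eventually.of_forall fun t => ?_)
    simp only [RCLike.conj_ofReal, RCLike.real_smul_eq_coe_mul]
    ring
  · intro t ht
    rw [hφ0 t ht, zero_smul]

namespace IsDeviatingEigensystem

variable {μ : ℝ} {lam : ℕ → 𝕜} {v : ℕ → ℝ → 𝕜}

theorem memLp (hv : IsDeviatingEigensystem μ lam v) (m : ℕ) : MemLp (v m) 2 unitMeasure :=
  (hv.solves m).memLp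

theorem orthonormal_toLp (hv : IsDeviatingEigensystem μ lam v) :
    Orthonormal 𝕜 fun m => (hv.memLp m).toLp (v m) := by
  classical
  rw [orthonormal_iff_ite]
  intro m m'
  rw [inner_toLp_left, show (if m = m' then (1 : 𝕜) else 0) = if m' = m then 1 else 0 by
    simp only [eq_comm], ← hv.orthonormal m' m, intervalIntegral_eq_integral_unit]
  refine integral_congr_ae ?_
  filter_upwards [(hv.memLp m').coeFn_toLp] with t ht
  rw [ht]

theorem eigenvalue_ne_zero (hv : IsDeviatingEigensystem μ lam v) (hμ : 1 ≤ μ) (m : ℕ) :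
    lam m ≠ 0 := by
  intro h0
  have ha : Real.sqrt μ ≠ 0 := (Real.sqrt_pos.2 (by linarith)).ne'
  obtain ⟨A, _, hA, _⟩ := exists_deviating_kernelOp (𝕜 := 𝕜) (Real.one_le_sqrt.2 hμ)
  have hs := hv.solves m
  rw [← Real.sq_sqrt (zero_le_one.trans hμ)] at hs
  have h1 := hs.toLp_eq_smul ha hA (hv.memLp m)
  rw [h0, zero_smul] at h1
  exact hv.orthonormal_toLp.ne_zero m h1

theorem conj_eigenvalue (hv : IsDeviatingEigensystem μ lam v) (m : ℕ) :
    (starRingEnd 𝕜) (lam m) = lam m :=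
  (hv.solves m).conj_eigenvalue (by
    rw [← intervalIntegral_eq_integral_unit, hv.orthonormal m m, if_pos rfl])

/-- All eigenvalues except the smallest one are bounded away from zero, uniformly in `μ`. -/
theorem two_le_norm_eigenvalue (hv : IsDeviatingEigensystem μ lam v) (hμ : 1 ≤ μ) {m : ℕ}
    (hm : m ≠ 0) : 2 ≤ ‖lam m‖ := by
  have ha : Real.sqrt μ ≠ 0 := (Real.sqrt_pos.2 (by linarith)).ne'
  obtain ⟨A, l, hA, hl⟩ := exists_deviating_kernelOp (𝕜 := 𝕜) (Real.one_le_sqrt.2 hμ)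
  have heig : ∀ m, A ((hv.memLp m).toLp (v m)) = (lam m)⁻¹ • (hv.memLp m).toLp (v m) := by
    intro m
    have hs := hv.solves m
    rw [← Real.sq_sqrt (zero_le_one.trans hμ)] at hs
    conv_rhs => rw [hs.toLp_eq_smul ha hA (hv.memLp m), smul_smul, inv_mul_cancel₀ (hv.eigenvalue_ne_zero hμ m),
      one_smul]
  have h0 := norm_pos_iff.2 (hv.eigenvalue_ne_zero hμ 0)
  have h1 := norm_pos_iff.2 (hv.eigenvalue_ne_zero hμ m)
  -- Passing to reciprocals turns the eigenvalue of least modulus into the largest eigenvalue of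
  -- `A`, the one exempt from the bound `1/2`.
  have := norm_eigenvalue_le_of_le_on_ker hl (hv.orthonormal_toLp.1 0) (hv.orthonormal_toLp.1 m)
    (hv.orthonormal_toLp.2 hm.symm) (heig 0) (heig m) (by
      rw [norm_inv, norm_inv]
      exact inv_anti₀ h0 (hv.least m))
  rw [norm_inv, one_div] at this
  exact (inv_le_inv₀ h1 two_pos).1 this

/-- The eigenfunctions of the deviating problem are complete in `L₂(0, 1)`. -/
theorem eq_zero_of_forall_inner_eq_zero (hv : IsDeviatingEigensystem μ lam v) (hμ : 1 ≤ μ)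
    {g : Lp 𝕜 2 unitMeasure} (hg : ∀ m, inner 𝕜 ((hv.memLp m).toLp (v m)) g = 0) : g = 0 := by
  have ha : Real.sqrt μ ≠ 0 := (Real.sqrt_pos.2 (by linarith)).ne'
  have ha2 : Real.sqrt μ ^ 2 = μ := Real.sq_sqrt (zero_le_one.trans hμ)
  obtain ⟨A, _, hA, _⟩ := exists_deviating_kernelOp (𝕜 := 𝕜) (Real.one_le_sqrt.2 hμ)
  set a := Real.sqrt μ
  have hAc := hA.isCompactOperator_hankel (continuous_fundSol a)
  have hAs := hA.isSymmetric_hankel (continuous_fundSol a)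
  let W : Submodule 𝕜 (Lp 𝕜 2 unitMeasure) :=
    (Submodule.span 𝕜 (range fun m => (hv.memLp m).toLp (v m)))ᗮ
  have hW : ∀ {x}, x ∈ W ↔ ∀ m, inner 𝕜 ((hv.memLp m).toLp (v m)) x = 0 := by
    intro x
    constructor
    · exact fun h m => h _ (Submodule.subset_span ⟨m, rfl⟩)
    · intro h u hu
      induction hu using Submodule.span_induction with
      | mem u hu => obtain ⟨m, rfl⟩ := hu; exact h m
      | zero => exact inner_zero_left _
      | add u w _ _ h1 h2 => rw [inner_add_left, h1, h2, add_zero]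
      | smul c u _ h1 => rw [inner_smul_left, h1, mul_zero]
  have hinv : ∀ x ∈ W, (A : Lp 𝕜 2 unitMeasure →ₗ[𝕜] Lp 𝕜 2 unitMeasure) x ∈ W := by
    intro x hx
    rw [hW] at hx ⊢
    intro m
    have hs := hv.solves m
    rw [← ha2] at hs
    have h1 := hs.toLp_eq_smul ha hA (hv.memLp m)
    have h2 := hx m
    rw [h1, inner_smul_left, mul_eq_zero] at h2
    rw [← hAs]
    refine h2.resolve_left ?_
    rw [hv.conj_eigenvalue]
    exact hv.eigenvalue_ne_zero hμ m
  let S : W →L[𝕜] W := A.restrict hinv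
  have hSc : IsCompactOperator S := hAc.restrict' hinv
  have hSs : (S : W →ₗ[𝕜] W).IsSymmetric := hAs.restrict_invariant hinv
  -- A compact symmetric operator whose only possible eigenvalue is zero vanishes. An eigenvector in
  -- `W` with `ν ≠ 0` would be an eigenfunction orthogonal to all `v m`, which `exhaustive`
  -- excludes.
  have hS : S = 0 := by
    refine (ContinuousLinearMap.eq_zero_of_forall_hasEigenvalue_eq_zero hSc hSs).1 fun ν hν => ?_
    by_contra hν0
    obtain ⟨x, hx⟩ := hν.exists_hasEigenvector
    have hx0 : (x : Lp 𝕜 2 unitMeasure) ≠ 0 := fun h => hx.2 (Subtype.ext h)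
    have hxA : A (x : Lp 𝕜 2 unitMeasure) = ν • (x : Lp 𝕜 2 unitMeasure) :=
      congrArg Subtype.val hx.apply_eq_smul
    have hxW := hW.1 x.2
    generalize (x : Lp 𝕜 2 unitMeasure) = g at hx0 hxA hxW
    -- An `L₂` eigenvector is only a class; `ν⁻¹ A g` supplies a continuous representative. Feeding
    -- it once more into Duhamel's formula yields a `C²` solution.
    set y₀ : ℝ → 𝕜 := fun t => ν⁻¹ • ∫ s, fundSol a (t + s - 1) • g s ∂unitMeasure with hy₀
    have hy₀c : Continuous y₀ := (continuous_integral_kernel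
      (continuous_uncurry_hankel (continuous_fundSol a)) g).const_smul ν⁻¹
    have hgy : g =ᵐ[unitMeasure] y₀ := by
      have := hA g
      rw [hxA] at this
      filter_upwards [this, Lp.coeFn_smul ν g] with t h1 h2
      rw [hy₀]
      simp only
      rw [← h1, h2, Pi.smul_apply, smul_smul, inv_mul_cancel₀ hν0, one_smul]
    obtain ⟨y, y₁, hd, hy⟩ := hasZeroCauchyData_integral_fundSol (𝕜 := 𝕜) ha
      (h := fun t => ν⁻¹ • y₀ (1 - t)) (by fun_prop)
    have hyy : ∀ t ∈ Icc (0 : ℝ) 1, y t = y₀ t := by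
      intro t ht
      rw [hy t ht, intervalIntegral_eq_integral_unit, hy₀]
      simp only
      rw [← integral_smul]
      refine integral_congr_ae ?_
      filter_upwards [hgy] with s hs
      rw [hs, sub_sub_cancel, smul_comm]
    have hsol : SolvesDeviating μ ν⁻¹ y := by
      refine ⟨hd.contDiffOn, fun t ht => ?_, hd.zero, ?_⟩
      · rw [hd.iteratedDeriv_two ht, ha2, hyy (1 - t) (HasZeroCauchyData.one_sub_mem_Icc
          (Ioo_subset_Icc_self ht)), RCLike.real_smul_eq_coe_mul, smul_eq_mul]
        ring
      · have := hd.deriv 0 (by simp)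
        rwa [hd.zero₁] at this
    have hz := hv.exhaustive _ y hsol fun m => by
      rw [← hxW m, inner_toLp_left, intervalIntegral_eq_integral_unit]
      refine integral_congr_ae ?_
      filter_upwards [hgy, ae_restrict_mem measurableSet_Ioo] with t h1 ht
      rw [h1, hyy t (Ioo_subset_Icc_self ht)]
    refine hx0 (Lp.eq_zero_iff_ae_eq_zero.2 ?_)
    filter_upwards [hgy, ae_restrict_mem measurableSet_Ioo] with t h1 ht
    rw [h1, ← hyy t (Ioo_subset_Icc_self ht), hz t (Ioo_subset_Icc_self ht), Pi.zero_apply]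
  -- `S = 0` means that `A` annihilates `W`, and `A` is injective.
  refine hA.eq_zero_of_fundSol ha ?_
  exact congrArg Subtype.val (DFunLike.congr_fun hS ⟨g, hW.2 hg⟩)

end IsDeviatingEigensystem

end DeviatingProblem

/-! ### Fubini, products and completeness in `L₂(D)`. -/

section Cylinder

variable {𝕜 : Type*} [RCLike 𝕜] {d : ℕ} {Ω : Set (EuclideanSpace ℝ (Fin d))}

theorem cylMeasure_eq_prod (Ω : Set (EuclideanSpace ℝ (Fin d))) :
    cylMeasure Ω = (volume.restrict Ω).prod unitMeasure := by
  rw [Measure.prod_restrict, ← Measure.volume_eq_prod]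

theorem measurePreserving_one_sub :
    MeasurePreserving (fun t : ℝ => 1 - t) unitMeasure unitMeasure := by
  have := (Measure.measurePreserving_sub_left (volume : Measure ℝ) 1).restrict_preimage
    (measurableSet_Ioo (a := (0 : ℝ)) (b := 1))
  have h : (fun t : ℝ => 1 - t) ⁻¹' Ioo 0 1 = Ioo 0 1 := by
    ext t
    simp only [mem_preimage, mem_Ioo, sub_pos, sub_lt_self_iff]
    exact and_comm
  rwa [h] at this

/-- The reflection `(x, t) ↦ (x, 1 - t)` preserves the measure of the cylinder. -/
theorem measurePreserving_reflection (Ω : Set (EuclideanSpace ℝ (Fin d))) :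
    MeasurePreserving (fun p : EuclideanSpace ℝ (Fin d) × ℝ => (p.1, 1 - p.2)) (cylMeasure Ω)
      (cylMeasure Ω) := by
  rw [cylMeasure_eq_prod]
  exact (MeasurePreserving.id _).prod measurePreserving_one_sub

theorem integral_cyl_eq_time_space {F : EuclideanSpace ℝ (Fin d) × ℝ → 𝕜}
    (hF : Integrable F (cylMeasure Ω)) :
    ∫ p, F p ∂(cylMeasure Ω) = ∫ t, (∫ x in Ω, F (x, t)) ∂unitMeasure := by
  rw [cylMeasure_eq_prod] at hF ⊢
  exact integral_prod_symm F hF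

theorem integral_cyl_eq_space_time {F : EuclideanSpace ℝ (Fin d) × ℝ → 𝕜}
    (hF : Integrable F (cylMeasure Ω)) :
    ∫ p, F p ∂(cylMeasure Ω) = ∫ x in Ω, ∫ t, F (x, t) ∂unitMeasure := by
  rw [cylMeasure_eq_prod] at hF ⊢
  exact integral_prod F hF

theorem integral_cyl_mul (φ : EuclideanSpace ℝ (Fin d) → 𝕜) (v : ℝ → 𝕜) :
    ∫ p, φ p.1 * v p.2 ∂(cylMeasure Ω) = (∫ x in Ω, φ x) * ∫ t, v t ∂unitMeasure := by
  rw [cylMeasure_eq_prod]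
  exact integral_prod_mul φ v

theorem memLp_prodFun {φ : EuclideanSpace ℝ (Fin d) → 𝕜} {v : ℝ → 𝕜}
    (hφ : MemLp φ 2 (volume.restrict Ω)) (hv : MemLp v 2 unitMeasure) :
    MemLp (prodFun φ v) 2 (cylMeasure Ω) := by
  rw [cylMeasure_eq_prod]
  have hm : AEStronglyMeasurable (prodFun φ v) ((volume.restrict Ω).prod unitMeasure) :=
    hφ.1.comp_fst.mul hv.1.comp_snd
  rw [memLp_two_iff_integrable_sq_norm hm]
  have := ((memLp_two_iff_integrable_sq_norm hφ.1).1 hφ).mul_prod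
    ((memLp_two_iff_integrable_sq_norm hv.1).1 hv)
  simpa only [prodFun, norm_mul, mul_pow] using this

theorem prodFun_ae_congr {φ φ' : EuclideanSpace ℝ (Fin d) → 𝕜} {v v' : ℝ → 𝕜}
    (hφ : φ =ᵐ[volume.restrict Ω] φ') (hv : v =ᵐ[unitMeasure] v') :
    prodFun φ v =ᵐ[cylMeasure Ω] prodFun φ' v' := by
  rw [cylMeasure_eq_prod]
  filter_upwards [Measure.quasiMeasurePreserving_fst.ae hφ,
    Measure.quasiMeasurePreserving_snd.ae hv] with p h1 h2
  simp only [prodFun, h1, h2]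

theorem inner_toLp_cyl {U : EuclideanSpace ℝ (Fin d) × ℝ → 𝕜} (hU : MemLp U 2 (cylMeasure Ω))
    (F : Lp 𝕜 2 (cylMeasure Ω)) :
    inner 𝕜 (hU.toLp U) F = ∫ p, F p * (starRingEnd 𝕜) (U p) ∂(cylMeasure Ω) := by
  rw [L2.inner_def]
  refine integral_congr_ae ?_
  filter_upwards [hU.coeFn_toLp] with t ht
  rw [ht, RCLike.inner_apply]

/-- The element of `L₂(D)` given by the product of `a ∈ L₂(Ω)` and `u ∈ L₂(0, 1)`. -/
noncomputable def tensorLp (a : L2 𝕜 Ω) (u : Lp 𝕜 2 unitMeasure) : Lp 𝕜 2 (cylMeasure Ω) :=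
  (memLp_prodFun (Lp.memLp a) (Lp.memLp u)).toLp (prodFun a u)

theorem coeFn_tensorLp (a : L2 𝕜 Ω) (u : Lp 𝕜 2 unitMeasure) :
    tensorLp a u =ᵐ[cylMeasure Ω] prodFun a u :=
  MemLp.coeFn_toLp _

theorem tensorLp_eq_of_ae {a : L2 𝕜 Ω} {u : Lp 𝕜 2 unitMeasure}
    {φ : EuclideanSpace ℝ (Fin d) → 𝕜} {v : ℝ → 𝕜} (hφ : a =ᵐ[volume.restrict Ω] φ)
    (hv : u =ᵐ[unitMeasure] v) : tensorLp a u =ᵐ[cylMeasure Ω] prodFun φ v :=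
  (coeFn_tensorLp a u).trans (prodFun_ae_congr hφ hv)

theorem inner_tensorLp (a b : L2 𝕜 Ω) (u v : Lp 𝕜 2 unitMeasure) :
    inner 𝕜 (tensorLp a u) (tensorLp b v) = inner 𝕜 a b * inner 𝕜 u v := by
  rw [L2.inner_def, L2.inner_def, L2.inner_def, ← integral_cyl_mul]
  refine integral_congr_ae ?_
  filter_upwards [coeFn_tensorLp a u, coeFn_tensorLp b v] with p h1 h2
  simp only [h1, h2, prodFun, RCLike.inner_apply, map_mul]
  ring

theorem norm_tensorLp (a : L2 𝕜 Ω) (u : Lp 𝕜 2 unitMeasure) :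
    ‖tensorLp a u‖ = ‖a‖ * ‖u‖ := by
  have h := inner_tensorLp a a u u
  simp only [inner_self_eq_norm_sq_to_K] at h
  norm_cast at h
  rw [← mul_pow] at h
  exact (pow_left_inj₀ (norm_nonneg _) (by positivity) two_ne_zero).1 h

theorem tensorLp_add_left (a b : L2 𝕜 Ω) (u : Lp 𝕜 2 unitMeasure) :
    tensorLp (a + b) u = tensorLp a u + tensorLp b u := by
  refine Lp.ext ?_
  filter_upwards [Lp.coeFn_add (tensorLp a u) (tensorLp b u), coeFn_tensorLp a u,
    coeFn_tensorLp b u, tensorLp_eq_of_ae (Lp.coeFn_add a b) (EventuallyEq.refl _ (u : ℝ → 𝕜))]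
    with p h1 h2 h3 h4
  rw [h4, h1, Pi.add_apply, h2, h3]
  simp only [prodFun, Pi.add_apply, add_mul]

theorem tensorLp_smul_left (c : 𝕜) (a : L2 𝕜 Ω) (u : Lp 𝕜 2 unitMeasure) :
    tensorLp (c • a) u = c • tensorLp a u := by
  refine Lp.ext ?_
  filter_upwards [Lp.coeFn_smul c (tensorLp a u), coeFn_tensorLp a u,
    tensorLp_eq_of_ae (Lp.coeFn_smul c a) (EventuallyEq.refl _ (u : ℝ → 𝕜))] with p h1 h2 h3
  rw [h3, h1, Pi.smul_apply, h2]
  simp only [prodFun, Pi.smul_apply, smul_eq_mul, mul_assoc]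

theorem continuous_tensorLp_left (u : Lp 𝕜 2 unitMeasure) :
    Continuous fun a : L2 𝕜 Ω => tensorLp a u := by
  let T : L2 𝕜 Ω →ₗ[𝕜] Lp 𝕜 2 (cylMeasure Ω) :=
    { toFun := fun a => tensorLp a u
      map_add' := fun a b => tensorLp_add_left a b u
      map_smul' := fun c a => tensorLp_smul_left c a u }
  exact (T.mkContinuous ‖u‖ fun a => by
    rw [mul_comm]
    exact (norm_tensorLp a u).le).continuous

/-- The partial Fourier coefficient of `F ∈ L₂(D)` with respect to `a ∈ L₂(Ω)`. -/
theorem exists_partial_coefficient (F : Lp 𝕜 2 (cylMeasure Ω)) :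
    (∀ᵐ t ∂unitMeasure, MemLp (fun x => F (x, t)) 2 (volume.restrict Ω)) ∧
    ∀ a : L2 𝕜 Ω, MemLp (fun t => ∫ x in Ω, F (x, t) * (starRingEnd 𝕜) (a x)) 2 unitMeasure := by
  have hm : AEStronglyMeasurable F ((volume.restrict Ω).prod unitMeasure) := by
    rw [← cylMeasure_eq_prod]; exact (Lp.memLp F).1
  have hi : Integrable (fun p => ‖F p‖ ^ 2) ((volume.restrict Ω).prod unitMeasure) := by
    rw [← cylMeasure_eq_prod]
    exact (memLp_two_iff_integrable_sq_norm (Lp.memLp F).1).1 (Lp.memLp F)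
  have hslice : ∀ᵐ t ∂unitMeasure, MemLp (fun x => F (x, t)) 2 (volume.restrict Ω) := by
    filter_upwards [hi.prod_left_ae, hm.prodMk_right] with t h1 h2
    exact (memLp_two_iff_integrable_sq_norm h2).2 h1
  refine ⟨hslice, fun a => ?_⟩
  have hmeas : AEStronglyMeasurable (fun t => ∫ x in Ω, F (x, t) * (starRingEnd 𝕜) (a x))
      unitMeasure := by
    have : AEStronglyMeasurable (fun p : EuclideanSpace ℝ (Fin d) × ℝ =>
        F p * (starRingEnd 𝕜) (a p.1)) ((volume.restrict Ω).prod unitMeasure) :=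
      hm.mul (RCLike.continuous_conj.comp_aestronglyMeasurable (Lp.memLp a).1.comp_fst)
    exact this.prod_swap.integral_prod_right'
  rw [memLp_two_iff_integrable_sq_norm hmeas]
  -- Cauchy–Schwarz in `x` bounds the squared coefficient by `‖a‖² ∫ |F(x, t)|² dx`, which is
  -- integrable in `t`.
  refine Integrable.mono' (hi.integral_prod_right.const_mul (‖a‖ ^ 2)) (hmeas.norm.pow 2) ?_
  filter_upwards [hslice] with t ht
  have e1 : ∫ x in Ω, F (x, t) * (starRingEnd 𝕜) (a x) = inner 𝕜 a (ht.toLp _) := by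
    rw [L2.inner_def]
    refine integral_congr_ae ?_
    filter_upwards [ht.coeFn_toLp] with x hx
    rw [hx, RCLike.inner_apply]
  have e2 : ∫ x in Ω, ‖F (x, t)‖ ^ 2 = ‖ht.toLp _‖ ^ 2 := by
    have h := inner_self_eq_norm_sq_to_K (𝕜 := 𝕜) (ht.toLp _)
    rw [L2.inner_def] at h
    have h' : ∫ x in Ω, inner 𝕜 (ht.toLp _ x) (ht.toLp _ x) =
        ((∫ x in Ω, ‖F (x, t)‖ ^ 2 : ℝ) : 𝕜) := by
      rw [← integral_ofReal]
      refine integral_congr_ae ?_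
      filter_upwards [ht.coeFn_toLp] with x hx
      rw [hx, inner_self_eq_norm_sq_to_K]
      norm_cast
    rw [h'] at h
    exact_mod_cast h
  rw [Real.norm_eq_abs, abs_of_nonneg (by positivity), e1, e2, ← mul_pow]
  exact pow_le_pow_left₀ (norm_nonneg _) (norm_inner_le_norm _ _) 2

theorem integrable_mul_conj {X : Type*} [MeasurableSpace X] {ρ : Measure X} {F U : X → 𝕜}
    (hF : MemLp F 2 ρ) (hU : MemLp U 2 ρ) :
    Integrable (fun p => F p * (starRingEnd 𝕜) (U p)) ρ :=
  MemLp.integrable_mul hF hU.star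

/-- Products of a complete system in `L₂(Ω)` with complete systems in `L₂(0, 1)` are complete in
`L₂(D)`. -/
theorem eq_zero_of_forall_inner_tensorLp {ι κ : Type*} [Countable ι] {a : ι → L2 𝕜 Ω}
    {u : ι → κ → Lp 𝕜 2 unitMeasure} (ha : ∀ x : L2 𝕜 Ω, (∀ k, inner 𝕜 (a k) x = 0) → x = 0)
    (hu : ∀ k, ∀ g : Lp 𝕜 2 unitMeasure, (∀ m, inner 𝕜 (u k m) g = 0) → g = 0)
    {F : Lp 𝕜 2 (cylMeasure Ω)} (hF : ∀ k m, inner 𝕜 (tensorLp (a k) (u k m)) F = 0) : F = 0 := by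
  obtain ⟨hslice, hcoef⟩ := exists_partial_coefficient F
  have hz : ∀ k, ∀ᵐ t ∂unitMeasure, ∫ x in Ω, F (x, t) * (starRingEnd 𝕜) (a k x) = 0 := by
    intro k
    have h0 : (hcoef (a k)).toLp _ = 0 := hu k _ fun m => ?_
    · filter_upwards [(hcoef (a k)).coeFn_toLp, Lp.eq_zero_iff_ae_eq_zero.1 h0] with t h1 h2
      rw [← h1, h2, Pi.zero_apply]
    rw [← hF k m, tensorLp, inner_toLp_cyl, integral_cyl_eq_time_space
      (integrable_mul_conj (Lp.memLp F) (memLp_prodFun (Lp.memLp _) (Lp.memLp _))), L2.inner_def]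
    refine integral_congr_ae ?_
    filter_upwards [(hcoef (a k)).coeFn_toLp] with t ht
    rw [ht, RCLike.inner_apply, ← integral_mul_const]
    refine integral_congr_ae (Eventually.of_forall fun x => ?_)
    simp only [prodFun, map_mul, mul_assoc]
  have hz' : ∀ᵐ t ∂unitMeasure, ∀ᵐ x ∂(volume.restrict Ω), F (x, t) = 0 := by
    -- Countability of `ι` unites the exceptional null sets: for almost every `t` the slice is
    -- orthogonal to all `a k` at once.
    filter_upwards [ae_all_iff.2 hz, hslice] with t h ht
    have h0 : ht.toLp _ = 0 := ha _ fun k => by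
      rw [← h k, L2.inner_def]
      refine integral_congr_ae ?_
      filter_upwards [ht.coeFn_toLp] with x hx
      rw [hx, RCLike.inner_apply]
    filter_upwards [ht.coeFn_toLp, Lp.eq_zero_iff_ae_eq_zero.1 h0] with x h1 h2
    rw [← h1, h2, Pi.zero_apply]
  rw [← norm_eq_zero, ← sq_eq_zero_iff, ← RCLike.ofReal_eq_zero (K := 𝕜), RCLike.ofReal_pow,
    ← inner_self_eq_norm_sq_to_K]
  have := inner_toLp_cyl (Lp.memLp F) F
  rw [Lp.toLp_coeFn] at this
  rw [this, integral_cyl_eq_time_space (integrable_mul_conj (Lp.memLp F) (Lp.memLp F))]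
  refine integral_eq_zero_of_ae ?_
  filter_upwards [hz'] with t ht
  refine integral_eq_zero_of_ae ?_
  filter_upwards [ht] with x hx
  rw [hx, zero_mul, Pi.zero_apply]

end Cylinder

/-! ### Bounds for derivatives up to the boundary. -/

section BoundedDerivatives

variable {E F : Type*} [NormedAddCommGroup E] [NormedSpace ℝ E] [NormedAddCommGroup F]
  [NormedSpace ℝ F]

/-- The derivatives of a function of class `Cⁿ` on a compact set `K` are bounded on every open
subset of `K`. No regularity of `K` is required. -/
theorem ContDiffOn.exists_bound_iteratedFDeriv {w : E → F} {K O : Set E} {n : ℕ}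
    (hw : ContDiffOn ℝ n w K) (hK : IsCompact K) (hO : IsOpen O) (hOK : O ⊆ K) :
    ∃ C, ∀ q ∈ O, ‖iteratedFDeriv ℝ n w q‖ ≤ C := by
  suffices ∃ C, ∀ q ∈ K ∩ O, ‖iteratedFDeriv ℝ n w q‖ ≤ C by
    obtain ⟨C, hC⟩ := this
    exact ⟨C, fun q hq => hC q ⟨hOK hq, hq⟩⟩
  -- The bound is local on `K`. Near each point of `K` a Taylor series within `K` has coefficients
  -- continuous there, hence bounded; at points of `O` openness makes these coefficients the true
  -- derivatives.
  refine hK.induction_on (p := fun s => ∃ C, ∀ q ∈ s ∩ O, ‖iteratedFDeriv ℝ n w q‖ ≤ C)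
    ⟨0, by simp⟩ (fun s t hst ⟨C, hC⟩ => ⟨C, fun q hq => hC q ⟨hst hq.1, hq.2⟩⟩) ?_ ?_
  · rintro s t ⟨C, hC⟩ ⟨D, hD⟩
    refine ⟨max C D, fun q hq => ?_⟩
    rcases hq.1 with h | h
    · exact (hC q ⟨h, hq.2⟩).trans (le_max_left _ _)
    · exact (hD q ⟨h, hq.2⟩).trans (le_max_right _ _)
  · intro x hx
    obtain ⟨u, hu, p, hp⟩ := contDiffWithinAt_nat.1 (hw x hx)
    rw [insert_eq_of_mem hx] at hu
    have hxu : x ∈ u := mem_of_mem_nhdsWithin hx hu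
    have hcont : ContinuousWithinAt (fun y => ‖p y n‖) u x := (hp.cont n le_rfl x hxu).norm
    have ht : {y | ‖p y n‖ < ‖p x n‖ + 1} ∈ 𝓝[K] x :=
      nhdsWithin_le_of_mem hu (hcont.eventually (gt_mem_nhds (lt_add_one _)))
    obtain ⟨V, hV, hxV, hVK⟩ := mem_nhdsWithin.1 (inter_mem hu ht)
    refine ⟨V ∩ K, inter_mem (mem_nhdsWithin_of_mem_nhds (hV.mem_nhds hxV)) self_mem_nhdsWithin,
      ‖p x n‖ + 1, fun q hq => ?_⟩
    have hVO : IsOpen (V ∩ O) := hV.inter hO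
    have hqVO : q ∈ V ∩ O := ⟨hq.1.1, hq.2⟩
    have hp' : HasFTaylorSeriesUpToOn n w p (V ∩ O) :=
      hp.mono fun y hy => (hVK ⟨hy.1, hOK hy.2⟩).1
    rw [← iteratedFDerivWithin_of_isOpen n hVO hqVO,
      ← hp'.eq_iteratedFDerivWithin_of_uniqueDiffOn le_rfl hVO.uniqueDiffOn hqVO]
    exact (hVK hq.1).2.le

theorem ContDiffAt.iteratedDeriv_two_prodMk {w : E × ℝ → F} {x : E} {t : ℝ}
    (hw : ContDiffAt ℝ 2 w (x, t)) :
    iteratedDeriv 2 (fun s => w (x, s)) t = iteratedFDeriv ℝ 2 w (x, t) fun _ => (0, 1) := by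
  have hl : ∀ s : ℝ, HasDerivAt (fun s => (x, s)) ((0 : E), (1 : ℝ)) s := fun s =>
    (hasDerivAt_const s x).prodMk (hasDerivAt_id s)
  have h1 : deriv (fun s => w (x, s)) =ᶠ[𝓝 t] fun s => fderiv ℝ w (x, s) (0, 1) := by
    have hev : ∀ᶠ q in 𝓝 (x, t), ContDiffAt ℝ 2 w q := hw.eventually (by simp)
    have hc : Tendsto (fun s : ℝ => (x, s)) (𝓝 t) (𝓝 (x, t)) := (hl t).continuousAt
    filter_upwards [hc.eventually hev] with s hs
    exact ((hs.differentiableAt two_ne_zero).hasFDerivAt.comp_hasDerivAt s (hl s)).deriv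
  rw [iteratedDeriv_succ, iteratedDeriv_one, h1.deriv_eq, iteratedFDeriv_two_apply]
  have h2 : ContDiffAt ℝ 1 (fderiv ℝ w) (x, t) := hw.fderiv_right (by norm_num)
  have h3 := (h2.differentiableAt one_ne_zero).hasFDerivAt.comp_hasDerivAt t (hl t)
  exact (h3.clm_apply (hasDerivAt_const t ((0 : E), (1 : ℝ)))).deriv.trans (by simp)

end BoundedDerivatives

/-! ### Integrability of admissible functions and of their second time derivative. -/

section AdmissibleFunctions

variable {𝕜 : Type*} [RCLike 𝕜] {d : ℕ} {Ω : Set (EuclideanSpace ℝ (Fin d))}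

/-- The second derivative in the time variable. -/
noncomputable def timeDeriv₂ (w : EuclideanSpace ℝ (Fin d) × ℝ → 𝕜) :
    EuclideanSpace ℝ (Fin d) × ℝ → 𝕜 :=
  fun p => iteratedDeriv 2 (fun s => w (p.1, s)) p.2

theorem isFiniteMeasure_cylMeasure (hΩ : Bornology.IsBounded Ω) :
    IsFiniteMeasure (cylMeasure Ω) :=
  ⟨by
    rw [Measure.restrict_apply_univ]
    exact (hΩ.prod (Metric.isBounded_Ioo 0 1)).measure_lt_top⟩

theorem memLp_of_continuousOn_of_bound (hΩo : IsOpen Ω) (hΩ : Bornology.IsBounded Ω)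
    {w : EuclideanSpace ℝ (Fin d) × ℝ → 𝕜} (hw : ContinuousOn w (Ω ×ˢ Ioo 0 1)) {C : ℝ}
    (hC : ∀ p ∈ Ω ×ˢ Ioo (0 : ℝ) 1, ‖w p‖ ≤ C) : MemLp w 2 (cylMeasure Ω) := by
  have hms : MeasurableSet (Ω ×ˢ Ioo (0 : ℝ) 1) := (hΩo.prod isOpen_Ioo).measurableSet
  have := isFiniteMeasure_cylMeasure hΩ
  refine MemLp.of_bound (hw.aestronglyMeasurable hms) C ?_
  filter_upwards [ae_restrict_mem hms] with p hp
  exact hC p hp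

/-- The time slices of a bounded continuous function on the cylinder are square integrable. -/
theorem memLp_slice (hΩo : IsOpen Ω) (hΩ : Bornology.IsBounded Ω)
    {w : EuclideanSpace ℝ (Fin d) × ℝ → 𝕜} (hw : ContinuousOn w (Ω ×ˢ Ioo 0 1))
    (hC : ∃ C, ∀ p ∈ Ω ×ˢ Ioo (0 : ℝ) 1, ‖w p‖ ≤ C) {t : ℝ} (ht : t ∈ Ioo (0 : ℝ) 1) :
    MemLp (fun x => w (x, t)) 2 (volume.restrict Ω) := by
  obtain ⟨C, hC⟩ := hC
  have : IsFiniteMeasure (volume.restrict Ω) := ⟨by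
    rw [Measure.restrict_apply_univ]; exact hΩ.measure_lt_top⟩
  refine MemLp.of_bound (ContinuousOn.aestronglyMeasurable
    (hw.comp (by fun_prop) fun x hx => ⟨hx, ht⟩) hΩo.measurableSet) C ?_
  filter_upwards [ae_restrict_mem hΩo.measurableSet] with x hx
  exact hC (x, t) ⟨hx, ht⟩

namespace IsAdmissible

variable {L : L2 𝕜 Ω →ₗ.[𝕜] L2 𝕜 Ω} {w : EuclideanSpace ℝ (Fin d) × ℝ → 𝕜}

theorem contDiffAt (hw : IsAdmissible Ω L w) (hΩo : IsOpen Ω)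
    {p : EuclideanSpace ℝ (Fin d) × ℝ} (hp : p ∈ Ω ×ˢ Ioo (0 : ℝ) 1) : ContDiffAt ℝ 2 w p :=
  hw.contDiffOn.contDiffAt (mem_of_superset ((hΩo.prod isOpen_Ioo).mem_nhds hp)
    (prod_mono subset_closure Ioo_subset_Icc_self))

theorem continuousOn (hw : IsAdmissible Ω L w) : ContinuousOn w (Ω ×ˢ Ioo 0 1) :=
  hw.contDiffOn.continuousOn.mono (prod_mono subset_closure Ioo_subset_Icc_self)

theorem isCompact_closure (hΩ : Bornology.IsBounded Ω) :
    IsCompact (closure Ω ×ˢ Icc (0 : ℝ) 1) :=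
  hΩ.isCompact_closure.prod isCompact_Icc

theorem exists_bound (hw : IsAdmissible Ω L w) (hΩ : Bornology.IsBounded Ω) :
    ∃ C, ∀ p ∈ Ω ×ˢ Ioo (0 : ℝ) 1, ‖w p‖ ≤ C := by
  obtain ⟨C, hC⟩ := (isCompact_closure hΩ).exists_bound_of_continuousOn hw.contDiffOn.continuousOn
  exact ⟨C, fun p hp => hC p (prod_mono subset_closure Ioo_subset_Icc_self hp)⟩

theorem memLp (hw : IsAdmissible Ω L w) (hΩo : IsOpen Ω) (hΩ : Bornology.IsBounded Ω) :
    MemLp w 2 (cylMeasure Ω) := by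
  obtain ⟨C, hC⟩ := hw.exists_bound hΩ
  exact memLp_of_continuousOn_of_bound hΩo hΩ hw.continuousOn hC

theorem timeDeriv₂_eq (hw : IsAdmissible Ω L w) (hΩo : IsOpen Ω) :
    EqOn (timeDeriv₂ w) (fun p => iteratedFDeriv ℝ 2 w p fun _ => (0, 1)) (Ω ×ˢ Ioo 0 1) :=
  fun _ hp => (hw.contDiffAt hΩo hp).iteratedDeriv_two_prodMk

theorem exists_bound_timeDeriv₂ (hw : IsAdmissible Ω L w) (hΩo : IsOpen Ω)
    (hΩ : Bornology.IsBounded Ω) : ∃ C, ∀ p ∈ Ω ×ˢ Ioo (0 : ℝ) 1, ‖timeDeriv₂ w p‖ ≤ C := by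
  obtain ⟨C, hC⟩ := ContDiffOn.exists_bound_iteratedFDeriv (n := 2) hw.contDiffOn
    (isCompact_closure hΩ) (hΩo.prod isOpen_Ioo) (prod_mono subset_closure Ioo_subset_Icc_self)
  refine ⟨C, fun p hp => ?_⟩
  rw [hw.timeDeriv₂_eq hΩo hp]
  refine (ContinuousMultilinearMap.le_opNorm _ _).trans ?_
  simpa [Prod.norm_def] using hC p hp

theorem continuousOn_timeDeriv₂ (hw : IsAdmissible Ω L w) (hΩo : IsOpen Ω) :
    ContinuousOn (timeDeriv₂ w) (Ω ×ˢ Ioo 0 1) := by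
  refine ContinuousOn.congr ?_ (hw.timeDeriv₂_eq hΩo)
  intro p hp
  have h := ((hw.contDiffAt hΩo hp).iteratedFDeriv_right (m := 0) (i := 2) (by norm_num)).continuousAt
  exact ((ContinuousMultilinearMap.apply ℝ _ 𝕜 fun _ => ((0 : EuclideanSpace ℝ (Fin d)),
    (1 : ℝ))).continuous.continuousAt.comp h).continuousWithinAt

theorem memLp_timeDeriv₂ (hw : IsAdmissible Ω L w) (hΩo : IsOpen Ω)
    (hΩ : Bornology.IsBounded Ω) : MemLp (timeDeriv₂ w) 2 (cylMeasure Ω) := by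
  obtain ⟨C, hC⟩ := hw.exists_bound_timeDeriv₂ hΩo hΩ
  exact memLp_of_continuousOn_of_bound hΩo hΩ (hw.continuousOn_timeDeriv₂ hΩo) hC

theorem hasZeroCauchyData (hw : IsAdmissible Ω L w) {x : EuclideanSpace ℝ (Fin d)} (hx : x ∈ Ω) :
    ∃ y₁ y₂, HasZeroCauchyData (fun t => w (x, t)) y₁ y₂ ∧
      ∀ t ∈ Ioo (0 : ℝ) 1, timeDeriv₂ w (x, t) = y₂ t := by
  obtain ⟨y₁, y₂, h⟩ := HasZeroCauchyData.of_contDiffOn (y := fun t => w (x, t))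
    (hw.contDiffOn.comp (by fun_prop) fun t ht => ⟨subset_closure hx, ht⟩)
    (hw.initial x hx) (hw.initial_deriv x hx)
  exact ⟨y₁, y₂, h, fun t ht => h.iteratedDeriv_two ht⟩

end IsAdmissible

end AdmissibleFunctions

/-! ### Coefficients of `w_tt - L w` against the product eigenfunctions. -/

section FourierCoefficients

variable {𝕜 : Type*} [RCLike 𝕜] {d : ℕ} {Ω : Set (EuclideanSpace ℝ (Fin d))}
  {L : L2 𝕜 Ω →ₗ.[𝕜] L2 𝕜 Ω}

theorem inner_apply_of_eigenvector {H : Type*} [NormedAddCommGroup H] [InnerProductSpace 𝕜 H]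
    [CompleteSpace H] {T : H →ₗ.[𝕜] H} (hT : IsSelfAdjoint T) {a : H} {μ : ℝ}
    (ha : ∃ h : T.domain, (h : H) = a ∧ T h = (μ : 𝕜) • a) (h : T.domain) :
    inner 𝕜 a (T h) = (μ : 𝕜) * inner 𝕜 a (h : H) := by
  obtain ⟨h₀, rfl, h₀eq⟩ := ha
  have key := LinearPMap.adjoint_isFormalAdjoint (T := T) hT.dense_domain
  rw [LinearPMap.isSelfAdjoint_def.1 hT] at key
  rw [← key h₀ h, h₀eq, inner_smul_left, RCLike.conj_ofReal]

theorem integrable_reflection_mul_conj {F U : EuclideanSpace ℝ (Fin d) × ℝ → 𝕜}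
    (hF : MemLp F 2 (cylMeasure Ω)) (hU : MemLp U 2 (cylMeasure Ω)) :
    Integrable (fun p => F (p.1, 1 - p.2) * (starRingEnd 𝕜) (U p)) (cylMeasure Ω) :=
  integrable_mul_conj (hF.comp_measurePreserving (measurePreserving_reflection Ω)) hU

theorem reflCoeff_prodFun_eq_time_space {F : EuclideanSpace ℝ (Fin d) × ℝ → 𝕜}
    (hF : MemLp F 2 (cylMeasure Ω)) (a : L2 𝕜 Ω) {v : ℝ → 𝕜} (hv : MemLp v 2 unitMeasure) :
    reflCoeff Ω F (prodFun a v) =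
      ∫ t, (∫ x in Ω, F (x, 1 - t) * (starRingEnd 𝕜) (a x)) * (starRingEnd 𝕜) (v t)
        ∂unitMeasure := by
  rw [reflCoeff, integral_cyl_eq_time_space
    (integrable_reflection_mul_conj hF (memLp_prodFun (Lp.memLp a) hv))]
  refine integral_congr_ae (Eventually.of_forall fun t => ?_)
  simp only
  rw [← integral_mul_const]
  refine integral_congr_ae (Eventually.of_forall fun x => ?_)
  simp only [prodFun, map_mul, mul_assoc]

/-- On almost every slice, self-adjointness moves `L` onto the eigenvector `a`, so after pairing
with `a` it acts as multiplication by `μ`. What is left is an ordinary differential expression in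
`t`. -/
theorem IsAdmissible.integral_slice_image {w g : EuclideanSpace ℝ (Fin d) × ℝ → 𝕜}
    (hw : IsAdmissible Ω L w) (hg : IsImage Ω L w g) (hΩo : IsOpen Ω)
    (hΩ : Bornology.IsBounded Ω) (hL : IsSelfAdjoint L) {μ : ℝ} {a : L2 𝕜 Ω}
    (ha : ∃ h : L.domain, (h : L2 𝕜 Ω) = a ∧ L h = (μ : 𝕜) • a) :
    ∀ᵐ t ∂unitMeasure, ∫ x in Ω, g (x, t) * (starRingEnd 𝕜) (a x) =
      ∫ x in Ω, (timeDeriv₂ w (x, t) - (μ : 𝕜) * w (x, t)) * (starRingEnd 𝕜) (a x) := by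
  filter_upwards [hg.2, ae_restrict_mem measurableSet_Ioo] with t ⟨h, hh, hgt⟩ ht
  have m1 := memLp_slice hΩo hΩ (hw.continuousOn_timeDeriv₂ hΩo)
    (hw.exists_bound_timeDeriv₂ hΩo hΩ) ht
  have m2 := memLp_slice hΩo hΩ hw.continuousOn (hw.exists_bound hΩ) ht
  have i1 := integrable_mul_conj m1 (Lp.memLp a)
  have i2 := integrable_mul_conj m2 (Lp.memLp a)
  have i3 := integrable_mul_conj (Lp.memLp (L h)) (Lp.memLp a)
  have e1 : ∫ x in Ω, g (x, t) * (starRingEnd 𝕜) (a x) =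
      ∫ x in Ω, (timeDeriv₂ w (x, t) * (starRingEnd 𝕜) (a x) - L h x * (starRingEnd 𝕜) (a x)) := by
    refine integral_congr_ae ?_
    filter_upwards [hgt] with x hx
    rw [hx, sub_mul]
    rfl
  have e2 : ∫ x in Ω, (timeDeriv₂ w (x, t) - (μ : 𝕜) * w (x, t)) * (starRingEnd 𝕜) (a x) =
      ∫ x in Ω, (timeDeriv₂ w (x, t) * (starRingEnd 𝕜) (a x) -
        (μ : 𝕜) * (w (x, t) * (starRingEnd 𝕜) (a x))) := by
    refine integral_congr_ae (Eventually.of_forall fun x => ?_)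
    simp only
    ring
  have e3 : ∫ x in Ω, L h x * (starRingEnd 𝕜) (a x) =
      (μ : 𝕜) * ∫ x in Ω, w (x, t) * (starRingEnd 𝕜) (a x) := by
    have := inner_apply_of_eigenvector hL ha h
    rw [L2.inner_def, L2.inner_def] at this
    simp only [RCLike.inner_apply] at this
    rw [this]
    congr 1
    refine integral_congr_ae ?_
    filter_upwards [hh] with x hx
    rw [hx]
  rw [e1, e2, integral_sub i1 i3, integral_sub i1 (i2.const_mul _), e3, integral_const_mul]

/-- The reflected Fourier coefficients of the image of an admissible function. -/
theorem IsAdmissible.reflCoeff_image {w g : EuclideanSpace ℝ (Fin d) × ℝ → 𝕜}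
    (hw : IsAdmissible Ω L w) (hg : IsImage Ω L w g) (hΩo : IsOpen Ω)
    (hΩ : Bornology.IsBounded Ω) (hL : IsSelfAdjoint L) {μ : ℝ} {a : L2 𝕜 Ω}
    (ha : ∃ h : L.domain, (h : L2 𝕜 Ω) = a ∧ L h = (μ : 𝕜) • a) {l : 𝕜} {v : ℝ → 𝕜}
    (hv : SolvesDeviating μ l v) (hl : (starRingEnd 𝕜) l = l) :
    reflCoeff Ω g (prodFun a v) =
      l * ∫ p, w p * (starRingEnd 𝕜) (prodFun a v p) ∂(cylMeasure Ω) := by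
  have mw := hw.memLp hΩo hΩ
  have mb := memLp_prodFun (Lp.memLp a) (hv.memLp (p := 2))
  have mD : MemLp (fun p => timeDeriv₂ w p - (μ : 𝕜) * w p) 2 (cylMeasure Ω) :=
    (hw.memLp_timeDeriv₂ hΩo hΩ).sub (mw.const_mul _)
  have h1 : reflCoeff Ω g (prodFun a v) =
      reflCoeff Ω (fun p => timeDeriv₂ w p - (μ : 𝕜) * w p) (prodFun a v) := by
    rw [reflCoeff_prodFun_eq_time_space hg.1 a hv.memLp,
      reflCoeff_prodFun_eq_time_space mD a hv.memLp]
    refine integral_congr_ae ?_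
    filter_upwards [measurePreserving_one_sub.quasiMeasurePreserving.ae
      (hw.integral_slice_image hg hΩo hΩ hL ha)] with t ht
    rw [ht]
  -- The order of integration is now exchanged: for fixed `x` the function `w(x, ·)` has zero Cauchy
  -- data and Green's identity in `t` applies.
  rw [h1, reflCoeff, integral_cyl_eq_space_time (integrable_reflection_mul_conj mD mb),
    integral_cyl_eq_space_time (integrable_mul_conj mw mb), ← integral_const_mul]
  refine setIntegral_congr_fun hΩo.measurableSet fun x hx => ?_
  obtain ⟨y₁, y₂, hy, hy₂⟩ := hw.hasZeroCauchyData hx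
  have hgreen := hv.green hy
  rw [hl] at hgreen
  calc ∫ t, (timeDeriv₂ w (x, 1 - t) - (μ : 𝕜) * w (x, 1 - t)) *
        (starRingEnd 𝕜) (prodFun a v (x, t)) ∂unitMeasure
      = (starRingEnd 𝕜) (a x) * ∫ t, (y₂ (1 - t) - (μ : 𝕜) * w (x, 1 - t)) *
        (starRingEnd 𝕜) (v t) ∂unitMeasure := by
        rw [← integral_const_mul]
        refine integral_unit_congr fun t ht => ?_
        rw [hy₂ _ (HasZeroCauchyData.one_sub_mem_Ioo ht), prodFun, map_mul]
        ring
    _ = l * ∫ t, w (x, t) * (starRingEnd 𝕜) (prodFun a v (x, t)) ∂unitMeasure := by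
        rw [hgreen, mul_left_comm, ← integral_const_mul]
        congr 1
        refine integral_unit_congr fun t _ => ?_
        rw [prodFun, map_mul]
        ring

end FourierCoefficients

/-! ### The closed graph of the Cauchy operator and its diagonal form. -/

section OperatorGraph

variable {𝕜 : Type*} [RCLike 𝕜] {d : ℕ} {Ω : Set (EuclideanSpace ℝ (Fin d))}
  {L : L2 𝕜 Ω →ₗ.[𝕜] L2 𝕜 Ω}

theorem IsAdmissible.add {w w' : EuclideanSpace ℝ (Fin d) × ℝ → 𝕜} (hw : IsAdmissible Ω L w)
    (hw' : IsAdmissible Ω L w') : IsAdmissible Ω L (w + w') where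
  contDiffOn := hw.contDiffOn.add hw'.contDiffOn
  initial x hx := by rw [Pi.add_apply, hw.initial x hx, hw'.initial x hx, add_zero]
  initial_deriv x hx :=
    ((hw.initial_deriv x hx).add (hw'.initial_deriv x hx)).congr_deriv (add_zero 0)
  mem_domain t ht := by
    obtain ⟨h, hh⟩ := hw.mem_domain t ht
    obtain ⟨h', hh'⟩ := hw'.mem_domain t ht
    refine ⟨h + h', ?_⟩
    filter_upwards [hh, hh', Lp.coeFn_add (h : L2 𝕜 Ω) (h' : L2 𝕜 Ω)] with x h1 h2 h3
    rw [Submodule.coe_add, h3, Pi.add_apply, h1, h2, Pi.add_apply]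

theorem IsAdmissible.smul {w : EuclideanSpace ℝ (Fin d) × ℝ → 𝕜} (hw : IsAdmissible Ω L w)
    (c : 𝕜) : IsAdmissible Ω L (c • w) where
  contDiffOn := hw.contDiffOn.const_smul c
  initial x hx := by rw [Pi.smul_apply, hw.initial x hx, smul_zero]
  initial_deriv x hx := ((hw.initial_deriv x hx).const_smul c).congr_deriv (smul_zero c)
  mem_domain t ht := by
    obtain ⟨h, hh⟩ := hw.mem_domain t ht
    refine ⟨c • h, ?_⟩
    filter_upwards [hh, Lp.coeFn_smul c (h : L2 𝕜 Ω)] with x h1 h3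
    rw [Submodule.coe_smul, h3, Pi.smul_apply, h1, Pi.smul_apply]

theorem IsImage.add {w w' g g' : EuclideanSpace ℝ (Fin d) × ℝ → 𝕜} (hg : IsImage Ω L w g)
    (hg' : IsImage Ω L w' g') (hΩo : IsOpen Ω) (hw : IsAdmissible Ω L w)
    (hw' : IsAdmissible Ω L w') : IsImage Ω L (w + w') (g + g') := by
  refine ⟨hg.1.add hg'.1, ?_⟩
  filter_upwards [hg.2, hg'.2, ae_restrict_mem measurableSet_Ioo]
    with t ⟨h, hh, hL⟩ ⟨h', hh', hL'⟩ ht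
  refine ⟨h + h', ?_, ?_⟩
  · filter_upwards [hh, hh', Lp.coeFn_add (h : L2 𝕜 Ω) (h' : L2 𝕜 Ω)] with x h1 h2 h3
    rw [Submodule.coe_add, h3, Pi.add_apply, h1, h2, Pi.add_apply]
  · filter_upwards [hL, hL', Lp.coeFn_add (L h) (L h'), ae_restrict_mem hΩo.measurableSet]
      with x h1 h2 h3 hx
    have hl : ContDiffAt ℝ 2 (fun s : ℝ => (x, s)) t := by fun_prop
    have hadd := iteratedDeriv_add (n := 2) ((hw.contDiffAt hΩo (p := (x, t)) ⟨hx, ht⟩).comp t hl)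
      ((hw'.contDiffAt hΩo (p := (x, t)) ⟨hx, ht⟩).comp t hl)
    rw [Pi.add_apply, h1, h2, L.map_add, h3, Pi.add_apply]
    refine Eq.trans ?_ (congrArg (· - (L h x + L h' x)) hadd.symm)
    simp only [Function.comp_def]
    ring

theorem IsImage.smul {w g : EuclideanSpace ℝ (Fin d) × ℝ → 𝕜} (hg : IsImage Ω L w g) (c : 𝕜) :
    IsImage Ω L (c • w) (c • g) := by
  refine ⟨hg.1.const_smul c, ?_⟩
  filter_upwards [hg.2] with t ⟨h, hh, hL⟩
  refine ⟨c • h, ?_, ?_⟩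
  · filter_upwards [hh, Lp.coeFn_smul c (h : L2 𝕜 Ω)] with x h1 h3
    rw [Submodule.coe_smul, h3, Pi.smul_apply, h1, Pi.smul_apply]
  · filter_upwards [hL, Lp.coeFn_smul c (L h)] with x h1 h3
    have hsm : iteratedDeriv 2 (fun s => c * w (x, s)) t = c * _ :=
      iteratedDeriv_const_mul_field c (fun s => w (x, s))
    rw [Pi.smul_apply, h1, L.map_smul, h3, Pi.smul_apply]
    simp only [Pi.smul_apply, smul_eq_mul, hsm, mul_sub]

theorem isAdmissible_zero : IsAdmissible Ω L 0 where
  contDiffOn := contDiffOn_const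
  initial _ _ := rfl
  initial_deriv _ _ := hasDerivWithinAt_const _ _ _
  mem_domain _ _ := ⟨0, Lp.coeFn_zero _ _ _⟩

theorem isImage_zero : IsImage Ω L 0 0 := by
  refine ⟨MemLp.zero, Eventually.of_forall fun t => ⟨0, Lp.coeFn_zero _ _ _, ?_⟩⟩
  filter_upwards [Lp.coeFn_zero 𝕜 2 (volume.restrict Ω)] with x hx
  have h0 : iteratedDeriv 2 (fun _ : ℝ => (0 : 𝕜)) t = 0 := by simp
  rw [L.map_zero, hx]
  simp only [Pi.zero_apply, h0, sub_zero]

/-- The graph in `L₂(D) × L₂(D)` of `∂²/∂t² - L` on the admissible functions. -/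
def operatorGraph (hΩo : IsOpen Ω) (L : L2 𝕜 Ω →ₗ.[𝕜] L2 𝕜 Ω) :
    Submodule 𝕜 (Lp 𝕜 2 (cylMeasure Ω) × Lp 𝕜 2 (cylMeasure Ω)) where
  carrier := {p | ∃ (w g : EuclideanSpace ℝ (Fin d) × ℝ → 𝕜) (hw : MemLp w 2 (cylMeasure Ω))
    (hg : MemLp g 2 (cylMeasure Ω)), IsAdmissible Ω L w ∧ IsImage Ω L w g ∧
      p = (hw.toLp w, hg.toLp g)}
  add_mem' := by
    rintro _ _ ⟨w, g, hw, hg, ha, hi, rfl⟩ ⟨w', g', hw', hg', ha', hi', rfl⟩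
    exact ⟨w + w', g + g', hw.add hw', hg.add hg', ha.add ha', hi.add hi' hΩo ha ha', by
      rw [MemLp.toLp_add, MemLp.toLp_add, Prod.mk_add_mk]⟩
  zero_mem' := ⟨0, 0, MemLp.zero, MemLp.zero, isAdmissible_zero, isImage_zero, rfl⟩
  smul_mem' := by
    rintro c _ ⟨w, g, hw, hg, ha, hi, rfl⟩
    exact ⟨c • w, c • g, hw.const_smul c, hg.const_smul c, ha.smul c, hi.smul c, by
      rw [MemLp.toLp_const_smul, MemLp.toLp_const_smul, Prod.smul_mk]⟩

/-- Sequential limits describe closures in a metric space. The closure is again a subspace, so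
partial sums of eigenfunction series can be handled in it directly. -/
theorem isStrongSolution_iff (hΩo : IsOpen Ω) (hΩ : Bornology.IsBounded Ω)
    {f u : EuclideanSpace ℝ (Fin d) × ℝ → 𝕜} (hf : MemLp f 2 (cylMeasure Ω)) :
    IsStrongSolution Ω L f u ↔ ∃ hu : MemLp u 2 (cylMeasure Ω),
      (hu.toLp u, hf.toLp f) ∈ (operatorGraph hΩo L).topologicalClosure := by
  constructor
  · rintro ⟨hu, w, g, hw, hg, hwu, hgf⟩
    refine ⟨hu, ?_⟩
    have h1 := (Lp.tendsto_Lp_iff_tendsto_eLpNorm'' w (fun n => (hw n).memLp hΩo hΩ) u hu).2 hwu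
    have h2 := (Lp.tendsto_Lp_iff_tendsto_eLpNorm'' g (fun n => (hg n).1) f hf).2 hgf
    exact mem_closure_of_tendsto (h1.prodMk_nhds h2)
      (Eventually.of_forall fun n => ⟨w n, g n, _, _, hw n, hg n, rfl⟩)
  · rintro ⟨hu, hmem⟩
    obtain ⟨p, hp, hlim⟩ := mem_closure_iff_seq_limit.1 hmem
    choose w g hw hg ha hi heq using hp
    have hp : p = fun n => ((hw n).toLp (w n), (hg n).toLp (g n)) := funext heq
    rw [hp] at hlim
    refine ⟨hu, w, g, ha, hi, ?_, ?_⟩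
    · exact (Lp.tendsto_Lp_iff_tendsto_eLpNorm'' w hw u hu).1 hlim.fst_nhds
    · exact (Lp.tendsto_Lp_iff_tendsto_eLpNorm'' g hg f hf).1 hlim.snd_nhds

/-- The reflection `F(x, t) ↦ F(x, 1 - t)` on `L₂(D)`. -/
noncomputable def reflectionLp (𝕜 : Type*) [RCLike 𝕜] (Ω : Set (EuclideanSpace ℝ (Fin d))) :
    Lp 𝕜 2 (cylMeasure Ω) →ₗᵢ[𝕜] Lp 𝕜 2 (cylMeasure Ω) :=
  Lp.compMeasurePreservingₗᵢ 𝕜 _ (measurePreserving_reflection Ω)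

theorem coeFn_reflectionLp (F : Lp 𝕜 2 (cylMeasure Ω)) :
    reflectionLp 𝕜 Ω F =ᵐ[cylMeasure Ω] fun p => F (p.1, 1 - p.2) :=
  Lp.coeFn_compMeasurePreserving F (measurePreserving_reflection Ω)

theorem coeFn_reflectionLp_of_ae {F : Lp 𝕜 2 (cylMeasure Ω)}
    {f : EuclideanSpace ℝ (Fin d) × ℝ → 𝕜} (h : F =ᵐ[cylMeasure Ω] f) :
    reflectionLp 𝕜 Ω F =ᵐ[cylMeasure Ω] fun p => f (p.1, 1 - p.2) :=
  (coeFn_reflectionLp F).trans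
    ((measurePreserving_reflection Ω).quasiMeasurePreserving.ae_eq_comp h)

theorem reflectionLp_reflectionLp (F : Lp 𝕜 2 (cylMeasure Ω)) :
    reflectionLp 𝕜 Ω (reflectionLp 𝕜 Ω F) = F := by
  refine Lp.ext ?_
  filter_upwards [coeFn_reflectionLp_of_ae (coeFn_reflectionLp F)] with p hp
  rw [hp]
  simp only [sub_sub_cancel]

theorem inner_toLp_reflectionLp {f U : EuclideanSpace ℝ (Fin d) × ℝ → 𝕜}
    (hf : MemLp f 2 (cylMeasure Ω)) (hU : MemLp U 2 (cylMeasure Ω)) :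
    inner 𝕜 (hU.toLp U) (reflectionLp 𝕜 Ω (hf.toLp f)) = reflCoeff Ω f U := by
  rw [inner_toLp_cyl, reflCoeff]
  refine integral_congr_ae ?_
  filter_upwards [coeFn_reflectionLp_of_ae hf.coeFn_toLp] with p hp
  rw [hp]

/-- The Fourier coefficients of the pairs in the closure of the graph. -/
theorem inner_reflectionLp_of_mem_closure (hΩo : IsOpen Ω) (hΩ : Bornology.IsBounded Ω)
    (hL : IsSelfAdjoint L) {μ : ℝ} {a : L2 𝕜 Ω}
    (ha : ∃ h : L.domain, (h : L2 𝕜 Ω) = a ∧ L h = (μ : 𝕜) • a) {l : 𝕜} {v : ℝ → 𝕜}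
    (hv : SolvesDeviating μ l v) (hl : (starRingEnd 𝕜) l = l)
    (hU : MemLp (prodFun a v) 2 (cylMeasure Ω))
    {p : Lp 𝕜 2 (cylMeasure Ω) × Lp 𝕜 2 (cylMeasure Ω)}
    (hp : p ∈ (operatorGraph hΩo L).topologicalClosure) :
    inner 𝕜 (hU.toLp _) (reflectionLp 𝕜 Ω p.2) = l * inner 𝕜 (hU.toLp _) p.1 := by
  -- Only inner products of `L₂(D)` enter, so the relation survives limits and need only be checked
  -- on the graph itself.
  have hcl : IsClosed {p : Lp 𝕜 2 (cylMeasure Ω) × Lp 𝕜 2 (cylMeasure Ω) |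
      inner 𝕜 (hU.toLp _) (reflectionLp 𝕜 Ω p.2) = l * inner 𝕜 (hU.toLp _) p.1} := by
    refine isClosed_eq ?_ ?_
    · exact continuous_const.inner ((reflectionLp 𝕜 Ω).continuous.comp continuous_snd)
    · exact continuous_const.mul (continuous_const.inner continuous_fst)
  refine closure_minimal ?_ hcl hp
  rintro _ ⟨w, g, hw, hg, hadm, him, rfl⟩
  change inner 𝕜 (hU.toLp _) (reflectionLp 𝕜 Ω (hg.toLp g)) = l * inner 𝕜 (hU.toLp _) (hw.toLp w)
  rw [inner_toLp_reflectionLp hg hU, hadm.reflCoeff_image him hΩo hΩ hL ha hv hl, inner_toLp_cyl]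
  congr 1
  refine integral_congr_ae ?_
  filter_upwards [hw.coeFn_toLp] with p hp
  rw [hp]

/-- Products of smooth elements of the domain with solutions of the deviating problem are
admissible. -/
theorem SolvesDeviating.prodFun_mem_operatorGraph (hΩo : IsOpen Ω) {μ : ℝ} {l : 𝕜} {v : ℝ → 𝕜}
    (hv : SolvesDeviating μ l v) {φ : EuclideanSpace ℝ (Fin d) → 𝕜} {h : L.domain}
    (hφ : ContDiffOn ℝ 2 φ (closure Ω)) (hh : (h : L2 𝕜 Ω) =ᵐ[volume.restrict Ω] φ)
    {V Z : Lp 𝕜 2 unitMeasure} (hV : V =ᵐ[unitMeasure] v)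
    (hZ : Z =ᵐ[unitMeasure] fun t => (μ : 𝕜) * v t + l * v (1 - t)) :
    (tensorLp (h : L2 𝕜 Ω) V, tensorLp (h : L2 𝕜 Ω) Z - tensorLp (L h) V) ∈
      operatorGraph hΩo L := by
  -- By the equation `z` is `v''` on `(0, 1)`, hence the image of `φ v` is `φ z - (L h) v`.
  set z : ℝ → 𝕜 := fun t => (μ : 𝕜) * v t + l * v (1 - t) with hz
  have mφ : MemLp φ 2 (volume.restrict Ω) := (memLp_congr_ae hh).1 (Lp.memLp _)
  have mz : MemLp z 2 unitMeasure := (memLp_congr_ae hZ).1 (Lp.memLp _)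
  have mw : MemLp (prodFun φ v) 2 (cylMeasure Ω) := memLp_prodFun mφ hv.memLp
  have mg : MemLp (prodFun φ z - prodFun (L h) v) 2 (cylMeasure Ω) :=
    (memLp_prodFun mφ mz).sub (memLp_prodFun (Lp.memLp _) hv.memLp)
  have hslice : ∀ t, ((v t • h : L.domain) : L2 𝕜 Ω) =ᵐ[volume.restrict Ω]
      fun x => prodFun φ v (x, t) := by
    intro t
    filter_upwards [hh, Lp.coeFn_smul (v t) (h : L2 𝕜 Ω)] with x h1 h2
    rw [Submodule.coe_smul, h2, Pi.smul_apply, h1, smul_eq_mul, mul_comm, prodFun]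
  refine ⟨prodFun φ v, prodFun φ z - prodFun (L h) v, mw, mg, ⟨?_, ?_, ?_, ?_⟩, ⟨mg, ?_⟩, ?_⟩
  · exact (hφ.comp contDiff_fst.contDiffOn fun p hp => hp.1).mul
      (hv.contDiffOn.comp contDiff_snd.contDiffOn fun p hp => hp.2)
  · intro x _
    rw [prodFun, hv.initial, mul_zero]
  · intro x _
    exact (hv.initial_deriv.const_mul (φ x)).congr_deriv (mul_zero _)
  · exact fun t _ => ⟨v t • h, hslice t⟩
  · filter_upwards [ae_restrict_mem measurableSet_Ioo] with t ht
    refine ⟨v t • h, hslice t, ?_⟩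
    filter_upwards [Lp.coeFn_smul (v t) (L h)] with x h1
    have hd : iteratedDeriv 2 (fun s => φ x * v s) t = φ x * iteratedDeriv 2 v t :=
      iteratedDeriv_const_mul_field (φ x) v
    have heq : iteratedDeriv 2 v t = z t := by
      simp only [hz, sub_eq_iff_eq_add'.1 (hv.equation t ht)]
    rw [L.map_smul, h1, Pi.smul_apply, Pi.sub_apply]
    simp only [prodFun, hd, heq, smul_eq_mul]
    rw [mul_comm (v t)]
  · refine Prod.ext (Lp.ext ?_) (Lp.ext ?_)
    · exact (tensorLp_eq_of_ae hh hV).trans mw.coeFn_toLp.symm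
    · filter_upwards [Lp.coeFn_sub (tensorLp (h : L2 𝕜 Ω) Z) (tensorLp (L h) V),
        tensorLp_eq_of_ae hh hZ, tensorLp_eq_of_ae (EventuallyEq.refl _ (L h : _ → 𝕜)) hV,
        mg.coeFn_toLp] with p h1 h2 h3 h4
      rw [h1, Pi.sub_apply, h2, h3, h4, Pi.sub_apply]

/-- The products of eigenfunctions lie in the domain of the closure of the graph. -/
theorem tensorLp_mem_closure_operatorGraph (hΩo : IsOpen Ω) (hcore : HasC2Core Ω L) {μ : ℝ}
    {a : L2 𝕜 Ω} (ha : ∃ h : L.domain, (h : L2 𝕜 Ω) = a ∧ L h = (μ : 𝕜) • a) {l : 𝕜} {v : ℝ → 𝕜}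
    (hv : SolvesDeviating μ l v) {V : Lp 𝕜 2 unitMeasure} (hV : V =ᵐ[unitMeasure] v) :
    (tensorLp a V, l • reflectionLp 𝕜 Ω (tensorLp a V)) ∈
      (operatorGraph hΩo L).topologicalClosure := by
  obtain ⟨h₀, rfl, h₀eq⟩ := ha
  have mz : MemLp (fun t => (μ : 𝕜) * v t + l * v (1 - t)) 2 unitMeasure :=
    memLp_of_continuousOn_unit ((continuousOn_const.mul hv.continuousOn).add
      (continuousOn_const.mul (HasZeroCauchyData.continuousOn_comp_one_sub hv.continuousOn)))
  set Z := mz.toLp _ with hZ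
  -- The eigenfunction `h₀` need not be `C²`; elements of the core approximate it in the graph norm,
  -- so both components of the pairs converge.
  choose φ g hφ hgφ hg1 hg2 using fun n : ℕ => hcore h₀ (1 / ((n : ℝ) + 1)) (by positivity)
  have hlim : ∀ {b : ℕ → L2 𝕜 Ω} {b₀ : L2 𝕜 Ω}, (∀ n : ℕ, ‖b n - b₀‖ < 1 / ((n : ℝ) + 1)) →
      Tendsto b atTop (𝓝 b₀) := fun hb =>
    tendsto_iff_norm_sub_tendsto_zero.2 (squeeze_zero (fun _ => norm_nonneg _)
      (fun n => (hb n).le) tendsto_one_div_add_atTop_nhds_zero_nat)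
  have l1 := hlim hg1
  have l2 := hlim hg2
  have hmem := mem_closure_of_tendsto
    ((((continuous_tensorLp_left V).tendsto _).comp l1).prodMk_nhds
      ((((continuous_tensorLp_left Z).tendsto _).comp l1).sub
        (((continuous_tensorLp_left V).tendsto _).comp l2)))
    (Eventually.of_forall fun n =>
      hv.prodFun_mem_operatorGraph hΩo (hφ n) (hgφ n) hV mz.coeFn_toLp)
  -- Since `L h₀ = μ h₀`, the part `μ v` of `Z` cancels and `l v(1 - t)` remains.
  have heq : tensorLp (h₀ : L2 𝕜 Ω) Z - tensorLp (L h₀) V =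
      l • reflectionLp 𝕜 Ω (tensorLp (h₀ : L2 𝕜 Ω) V) := by
    refine Lp.ext ?_
    filter_upwards [Lp.coeFn_sub (tensorLp (h₀ : L2 𝕜 Ω) Z) (tensorLp (L h₀) V),
      Lp.coeFn_smul l (reflectionLp 𝕜 Ω (tensorLp (h₀ : L2 𝕜 Ω) V)),
      tensorLp_eq_of_ae (EventuallyEq.refl _ (h₀ : L2 𝕜 Ω)) mz.coeFn_toLp,
      tensorLp_eq_of_ae (h₀eq ▸ Lp.coeFn_smul (μ : 𝕜) (h₀ : L2 𝕜 Ω)) hV,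
      coeFn_reflectionLp_of_ae (tensorLp_eq_of_ae (EventuallyEq.refl _ (h₀ : L2 𝕜 Ω)) hV)]
      with p h1 h2 h3 h4 h5
    rw [h1, h2, Pi.sub_apply, Pi.smul_apply, h3, h4, h5]
    simp only [prodFun, Pi.smul_apply, smul_eq_mul]
    ring
  rw [heq] at hmem
  exact hmem

end OperatorGraph

/-- A family of squares over `ℕ × ℕ` is summable if it is summable along the first column and
dominated by a summable family elsewhere. -/
theorem summable_prod_of_column {F G : ℕ × ℕ → ℝ} (hF : ∀ q, 0 ≤ F q) (hG : Summable G)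
    (hG0 : ∀ q, 0 ≤ G q) (hcol : Summable fun k => F (k, 0)) (hle : ∀ q, q.2 ≠ 0 → F q ≤ G q) :
    Summable F := by
  have hinj : Function.Injective fun k : ℕ => (k, 0) := fun _ _ h => congrArg Prod.fst h
  have h1 : Summable fun q : ℕ × ℕ => if q.2 = 0 then F q else 0 := by
    refine (hinj.summable_iff fun q hq => if_neg fun h => hq ⟨q.1, Prod.ext rfl h.symm⟩).1 ?_
    simpa [Function.comp_def] using hcol
  refine (h1.add hG).of_nonneg_of_le hF fun q => ?_
  by_cases h : q.2 = 0
  · simpa [h] using hG0 q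
  · simpa [h] using hle q h

theorem coeFn_sum_ae_eq {X E ι : Type*} [MeasurableSpace X] {ρ : Measure X}
    [NormedAddCommGroup E] {p : ENNReal} {a : ι → Lp E p ρ} {g : ι → X → E} (s : Finset ι)
    (h : ∀ i, a i =ᵐ[ρ] g i) : ⇑(∑ i ∈ s, a i) =ᵐ[ρ] ∑ i ∈ s, g i := by
  classical
  induction s using Finset.induction_on with
  | empty => simpa using Lp.coeFn_zero E p ρ
  | insert i s hi ih =>
    rw [Finset.sum_insert hi, Finset.sum_insert hi]
    exact (Lp.coeFn_add _ _).trans ((h i).add ih)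

/-! ### The Hilbert basis of product eigenfunctions. -/

section EigenfunctionBasis

variable {𝕜 : Type*} [RCLike 𝕜] {d : ℕ} {Ω : Set (EuclideanSpace ℝ (Fin d))}

theorem one_le_of_eigenvector {H : Type*} [NormedAddCommGroup H] [InnerProductSpace 𝕜 H]
    {T : H →ₗ.[𝕜] H} (hT : FriedrichsInequality T) {a : H} (ha1 : ‖a‖ = 1) {μ : ℝ}
    (ha : ∃ h : T.domain, (h : H) = a ∧ T h = (μ : 𝕜) • a) : 1 ≤ μ := by
  obtain ⟨h, rfl, hh⟩ := ha
  have := hT h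
  rw [hh, inner_smul_left, inner_self_eq_norm_sq_to_K, ha1] at this
  simpa using this

/-- The products of the eigenfunctions of `L` with the eigenfunctions of the deviating problems
form a Hilbert basis of `L₂(D)`. -/
theorem exists_hilbertBasis_prodFun {μ : ℕ → ℝ} (hμ : ∀ k, 1 ≤ μ k)
    (e : HilbertBasis ℕ 𝕜 (L2 𝕜 Ω)) {lam : ℕ → ℕ → 𝕜} {v : ℕ → ℕ → ℝ → 𝕜}
    (hv : ∀ k, IsDeviatingEigensystem (μ k) (lam k) (v k)) :
    ∃ b : HilbertBasis (ℕ × ℕ) 𝕜 (Lp 𝕜 2 (cylMeasure Ω)),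
      ∀ q, b q = tensorLp (e q.1) (((hv q.1).memLp q.2).toLp (v q.1 q.2)) := by
  classical
  set B : ℕ × ℕ → Lp 𝕜 2 (cylMeasure Ω) :=
    fun q => tensorLp (e q.1) (((hv q.1).memLp q.2).toLp (v q.1 q.2)) with hB
  have hon : Orthonormal 𝕜 B := by
    rw [orthonormal_iff_ite]
    rintro ⟨k, m⟩ ⟨k', m'⟩
    simp only [hB, inner_tensorLp, orthonormal_iff_ite.1 e.orthonormal]
    by_cases hk : k = k'
    · subst hk
      have := orthonormal_iff_ite.1 (hv k).orthonormal_toLp m m'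
      simp [this]
    · simp [hk]
  have hsp : (Submodule.span 𝕜 (range B))ᗮ = ⊥ := by
    refine (Submodule.eq_bot_iff _).2 fun F hF => ?_
    refine eq_zero_of_forall_inner_tensorLp (a := e)
      (u := fun k m => ((hv k).memLp m).toLp (v k m)) (fun x hx => ?_)
      (fun k g hg => (hv k).eq_zero_of_forall_inner_eq_zero (hμ k) hg)
      (fun k m => hF _ (Submodule.subset_span ⟨(k, m), rfl⟩))
    refine e.repr.injective (lp.ext (funext fun k => ?_))
    rw [e.repr_apply_apply, hx k, map_zero]
    rfl
  exact ⟨HilbertBasis.mkOfOrthogonalEqBot hon hsp, fun q => by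
    rw [HilbertBasis.coe_mkOfOrthogonalEqBot]⟩

end EigenfunctionBasis

theorem theorem2 {𝕜 : Type*} [RCLike 𝕜] {d : ℕ}
    (Ω : Set (EuclideanSpace ℝ (Fin d)))
    (hΩ_open : IsOpen Ω) (hΩ_conn : IsConnected Ω) (hΩ_bdd : Bornology.IsBounded Ω)
    (hΩ_smooth : HasSmoothBoundary Ω)
    (L : L2 𝕜 Ω →ₗ.[𝕜] L2 𝕜 Ω)
    (hL_sa : IsSelfAdjoint L) (hL_comp : HasCompactResolvent L)
    (hL_pos : FriedrichsInequality L) (hL_core : HasC2Core Ω L)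
    -- the eigenvalues and a complete orthonormal system of eigenfunctions of `L`
    (μ : ℕ → ℝ) (e : HilbertBasis ℕ 𝕜 (L2 𝕜 Ω))
    (he : ∀ k, ∃ h : L.domain, (h : L2 𝕜 Ω) = e k ∧ L h = (μ k : 𝕜) • e k)
    -- the eigenvalues and eigenfunctions of the problems with deviating argument
    (lam : ℕ → ℕ → 𝕜) (v : ℕ → ℕ → ℝ → 𝕜)
    (hv : ∀ k, IsDeviatingEigensystem (μ k) (lam k) (v k))
    (f : EuclideanSpace ℝ (Fin d) × ℝ → 𝕜) (hf : MemLp f 2 (cylMeasure Ω)) :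
    ((∃ u, IsStrongSolution Ω L f u) ↔
      Summable fun k => ‖reflCoeff Ω f (prodFun (e k) (v k 0)) / lam k 0‖ ^ 2) ∧
    -- every strong solution is the sum of the eigenfunction series, unconditionally in `L₂(D)`
    ∀ u, IsStrongSolution Ω L f u →
      Tendsto (fun s : Finset (ℕ × ℕ) =>
        eLpNorm (u - ∑ q ∈ s,
          (reflCoeff Ω f (prodFun (e q.1) (v q.1 q.2)) / lam q.1 q.2) •
            prodFun (e q.1) (v q.1 q.2)) 2 (cylMeasure Ω)) atTop (𝓝 0) := by
  have hμ : ∀ k, 1 ≤ μ k := fun k => one_le_of_eigenvector hL_pos (e.orthonormal.1 k) (he k)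
  have hlam : ∀ k m, lam k m ≠ 0 := fun k m => (hv k).eigenvalue_ne_zero (hμ k) m
  obtain ⟨b, hb⟩ := exists_hilbertBasis_prodFun hμ e hv
  have hU : ∀ q : ℕ × ℕ, MemLp (prodFun (e q.1) (v q.1 q.2)) 2 (cylMeasure Ω) := fun q =>
    memLp_prodFun (Lp.memLp _) ((hv q.1).memLp q.2)
  have hbU : ∀ q, b q = (hU q).toLp _ := fun q => by
    rw [hb]
    refine Lp.ext ((tensorLp_eq_of_ae (EventuallyEq.refl _ (e q.1 : _ → 𝕜))
      ((hv q.1).memLp q.2).coeFn_toLp).trans (hU q).coeFn_toLp.symm)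
  set c : ℕ × ℕ → 𝕜 := fun q => reflCoeff Ω f (prodFun (e q.1) (v q.1 q.2)) with hc
  set F := reflectionLp 𝕜 Ω (hf.toLp f) with hF
  have hcF : ∀ q, inner 𝕜 (b q) F = c q := fun q => by
    rw [hbU, hF, inner_toLp_reflectionLp hf (hU q)]
  -- The diagonal relation can be divided by the nonzero eigenvalue: `f` alone determines every
  -- coefficient of a strong solution.
  have hcoef : ∀ u, (hu : MemLp u 2 (cylMeasure Ω)) →
      (hu.toLp u, hf.toLp f) ∈ (operatorGraph hΩ_open L).topologicalClosure →
      ∀ q, inner 𝕜 (b q) (hu.toLp u) = c q / lam q.1 q.2 := by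
    intro u hu hmem q
    have := inner_reflectionLp_of_mem_closure hΩ_open hΩ_bdd hL_sa (he q.1)
      ((hv q.1).solves q.2) ((hv q.1).conj_eigenvalue q.2) (hU q) hmem
    rw [← hbU] at this
    rw [← hcF, hF, eq_div_iff (hlam _ _), mul_comm]
    exact this.symm
  refine ⟨⟨?_, ?_⟩, ?_⟩
  · rintro ⟨u, hu⟩
    obtain ⟨hum, hmem⟩ := (isStrongSolution_iff hΩ_open hΩ_bdd hf).1 hu
    have hs := b.orthonormal.inner_products_summable (hum.toLp u)
    -- Bessel's inequality for `u` makes the whole family square summable, in particular the column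
    -- `m = 0`, which carries the eigenvalues of least modulus.
    simp only [hcoef u hum hmem] at hs
    exact hs.comp_injective (i := fun k : ℕ => (k, 0)) fun _ _ h => congrArg Prod.fst h
  · intro hsum
    -- Off that column `|λ| ≥ 2`, so the quotients are dominated by the coefficients of `F`, which
    -- are always square summable.
    have hs : Summable fun q : ℕ × ℕ => ‖c q / lam q.1 q.2‖ ^ 2 := by
      have hcs := b.orthonormal.inner_products_summable F
      simp only [hcF] at hcs
      refine summable_prod_of_column (fun _ => by positivity) hcs (fun _ => by positivity) hsum
        fun q hq => ?_
      refine pow_le_pow_left₀ (norm_nonneg _) ?_ 2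
      rw [norm_div]
      exact div_le_self (norm_nonneg _)
        (one_le_two.trans ((hv q.1).two_le_norm_eigenvalue (hμ q.1) hq))
    have hmemlp : Memℓp (fun q : ℕ × ℕ => c q / lam q.1 q.2) 2 :=
      memℓp_gen (by simpa using hs)
    have hsumU := b.hasSum_repr_symm ⟨_, hmemlp⟩
    -- The reflection is an isometric involution, so applying it to the expansion of `F = P f`
    -- expands `f` in the reflected basis.
    have hsumF : HasSum (fun q => c q • reflectionLp 𝕜 Ω (b q)) (hf.toLp f) := by
      have h1 := (b.hasSum_repr F).mapL (reflectionLp 𝕜 Ω).toContinuousLinearMap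
      rw [show (reflectionLp 𝕜 Ω).toContinuousLinearMap F = hf.toLp f from
        reflectionLp_reflectionLp _] at h1
      convert h1 using 2 with q
      rw [b.repr_apply_apply, hcF, map_smul]
      rfl
    set U := b.repr.symm ⟨_, hmemlp⟩
    refine ⟨U, (isStrongSolution_iff hΩ_open hΩ_bdd hf).2 ⟨Lp.memLp U, ?_⟩⟩
    rw [Lp.toLp_coeFn]
    -- The partial sums of `U` and of `f` are paired term by term as `(c/λ) • (b, λ P b)`, each in
    -- the closed graph, and the limit stays there.
    refine (Submodule.isClosed_topologicalClosure _).mem_of_tendsto (hsumU.prodMk hsumF)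
      (Eventually.of_forall fun s => Submodule.sum_mem _ fun q _ => ?_)
    have := Submodule.smul_mem _ (c q / lam q.1 q.2) (tensorLp_mem_closure_operatorGraph hΩ_open
      hL_core (he q.1) ((hv q.1).solves q.2) ((hv q.1).memLp q.2).coeFn_toLp)
    rwa [← hb, Prod.smul_mk, smul_smul, div_mul_cancel₀ _ (hlam _ _)] at this
  · intro u hu
    obtain ⟨hum, hmem⟩ := (isStrongSolution_iff hΩ_open hΩ_bdd hf).1 hu
    have hsum := b.hasSum_repr (hum.toLp u)
    simp only [b.repr_apply_apply, hcoef u hum hmem] at hsum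
    have h2 := (Lp.tendsto_Lp_iff_tendsto_eLpNorm' _ _).1 hsum
    refine h2.congr fun s => ?_
    rw [← eLpNorm_neg]
    refine eLpNorm_congr_ae ?_
    have hsm : ⇑(∑ q ∈ s, (c q / lam q.1 q.2) • b q) =ᵐ[cylMeasure Ω]
        ∑ q ∈ s, (c q / lam q.1 q.2) • prodFun (e q.1) (v q.1 q.2) := by
      refine coeFn_sum_ae_eq s fun q => ?_
      refine (Lp.coeFn_smul _ _).trans ?_
      rw [hbU]
      exact (hU q).coeFn_toLp.const_smul _
    filter_upwards [hsm, hum.coeFn_toLp] with p h1 h2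
    rw [Pi.neg_apply, Pi.sub_apply, Pi.sub_apply, h1, h2, neg_sub]
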